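/- Write $\mathbf R^+=(0,\infty)$, $\|\cdot\|_2=\|\cdot\|_{L_2(\mathbf R^+)}$. For $\delta\ge 0$ let $B_\delta$ be the set of positive locally integrable functions $w$ on $\mathbf R^+$ for which there is a constant $C_w$ such that $\int_\Delta w\,dx\le C_w\int_{\frac12\Delta}w\,dx$ for every bounded interval $\Delta\subset\mathbf R^+$ of length $|\Delta|\ge\delta$, where $\frac12\Delta$ is the interval with the same centre and half the length. For an integer $l\ge 1$ and a weight $w>0$ on $\mathbf R^+$ let $W^{(l)}_{2,w}$ be the space of (real) functions $f$ on $\mathbf R^+$ with weak derivative $f^{(l)}$ and finite norm $\|f\|_{L_2(0,1)}+\|f^{(l)}w\|_2$. A function $\varphi$ on $\mathbf R^+$ is a (pointwise) multiplier from ${}^1W$ into ${}^2W$ if $\varphi f\in{}^2W$ for all $f\in{}^1W$. **Theorem 2.** Let $1\le m\le l$ be integers, and let $u,v$ be positive weights on $\mathbf R^+$ such that $u^{-2}\in B_\delta$ for some $\delta\ge0$ and $v^{-1}\in L_2(0,r)$ for all $r>0$. Then a function $\varphi$ is a multiplier from $W^{(l)}_{2,u}$ into $W^{(m)}_{2,v}$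 if and only if the weak derivatives $(\varphi x^k)^{(m)}$, $k=0,\dots,l-1$, exist on $\mathbf R^+$ and satisfy the two conditions $$\|(\varphi x^k)^{(m)}v\|_2<\infty,\qquad k=0,\dots,l-1,$$ $$\sup_{r>0}\|(\varphi x^k)^{(m)}v\|_{L_2(r,\infty)}\cdot\|x^{l-k-1}u^{-1}\|_{L_2(0,r)}<\infty,\qquad k=0,\dots,l-1,$$ and, in the case $m=l$, also the condition $$\|\varphi v u^{-1}\|_{L_\infty(\mathbf R^+)}<\infty.$$ -/

import Mathlib

open MeasureTheory Set
open scoped ENNReal NNReal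

namespace WeightedSobolev

/-- The class `B_δ`: a.e. positive, locally integrable functions `w` on `(0, ∞)` such that, for some
finite constant `C`, the integral of `w` over any bounded interval `(a, b) ⊆ (0, ∞)` of length at
least `δ` is at most `C` times the integral of `w` over the concentric interval of half the length.
The integrals are `[0, ∞]`-valued, so for `a = 0` the left-hand side is finite as part of the
condition. -/
def DoublingClass (δ : ℝ) (w : ℝ → ℝ) : Prop :=
  (∀ᵐ x ∂(volume.restrict (Ioi (0 : ℝ))), 0 < w x) ∧
  LocallyIntegrableOn w (Ioi (0 : ℝ)) ∧
  ∃ C : ℝ≥0, ∀ a b : ℝ, 0 ≤ a → a < b → δ ≤ b - a →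
    ∫⁻ x in Ioo a b, ENNReal.ofReal (w x) ≤
      C * ∫⁻ x in Ioo ((a + b) / 2 - (b - a) / 4) ((a + b) / 2 + (b - a) / 4), ENNReal.ofReal (w x)

/-- `g` is the weak (generalized) derivative of order `n` of `f` on `(0, ∞)`. On an interval, a weak
derivative of order one of `f` is a locally integrable `h` of which `f` is a.e. equal to an
indefinite integral (that is, `f` is a.e. equal to a locally absolutely continuous function whose
a.e. derivative is `h`); higher orders are obtained by iteration. -/
def IsWeakDeriv : ℕ → (ℝ → ℝ) → (ℝ → ℝ) → Prop
  | 0, f, g => f =ᵐ[volume.restrict (Ioi (0 : ℝ))] g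
  | n + 1, f, g => ∃ h : ℝ → ℝ, LocallyIntegrableOn h (Ioi (0 : ℝ)) ∧
      (∃ c : ℝ, f =ᵐ[volume.restrict (Ioi (0 : ℝ))] fun x => c + ∫ t in (1 : ℝ)..x, h t) ∧
      IsWeakDeriv n h g

/-- The weighted Sobolev space `W^{(l)}_{2,w}` on `(0, ∞)`: the functions with finite norm
`‖f‖_{L_2(0,1)} + ‖f^{(l)} w‖_{L_2(0,∞)}`. Only the values of `f` on `(0, ∞)` matter. -/
def sobolevSpace (l : ℕ) (w : ℝ → ℝ) : Set (ℝ → ℝ) :=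
  {f | MemLp f 2 (volume.restrict (Ioo (0 : ℝ) 1)) ∧
    ∃ g : ℝ → ℝ, IsWeakDeriv l f g ∧ MemLp (fun x => g x * w x) 2 (volume.restrict (Ioi (0 : ℝ)))}

/-- The pointwise multipliers from the function space `W₁` into the function space `W₂`. -/
def multipliers (W₁ W₂ : Set (ℝ → ℝ)) : Set (ℝ → ℝ) :=
  {φ | ∀ f ∈ W₁, (fun x => φ x * f x) ∈ W₂}

end WeightedSobolev

/-!
Let `f^{(l)} = g`. Variation of parameters in the fundamental system `x^k / k!` writes
`f = ∑_{k<l} a_k(x) x^k / k!` with `a_k(x) = α_k + ∫_0^x g(t) (-t)^{l-1-k} / (l-1-k)! dt`, and the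
derivatives of `f` of order less than `l` fall on the monomials only. By the Leibniz rule
`(φ f)^{(m)} = ∑_{k<l} a_k (φ x^k)^{(m)} / k!`, with the additional term `φ g` if `m = l`
(`isWeakDeriv_mul_taylorChain`). So `φ` is a multiplier exactly when this expression times `v` is in
`L²` whenever `h = g u` is.

Sufficiency: the constants `α_k` contribute multiples of `(φ x^k)^{(m)} v`, and the integral part
of the `k`-th term is the Hardy operator `h ↦ W(x) ∫_0^x q h` with `W = (φ x^k)^{(m)} v` and
`q = t^{l-k-1} / u`, which is bounded on `L²` by Muckenhoupt's criterion (`lintegral_hardy`); the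
supremum condition is that criterion. The additional term is `(φ v / u) h`.

Necessity: the functions `x^k` themselves give the first condition. By the closed graph theorem the
operator `h ↦ (φ f)^{(m)} v`, with all `α_k = 0`, is bounded on `L²`
(`exists_productDeriv_bound`). It is tested on an `h` supported in `(0, r)` for which all the moments
`∫ g t^i`, `i < l`, vanish except the one with `i = l-1-k`; to the right of `r` only the `k`-th term
survives and is a multiple of `(φ x^k)^{(m)} v`. The doubling condition on `u^{-2}` shows that such
an `h` exists with a norm comparable to the reciprocal of `‖t^{l-k-1} / u‖_{L²(0,r)}`, for `r` large
(`DoublingClass.exists_dual_polynomial`); small `r` are harmless. If `m = l`, subtracting the Hardy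
operators, now known to be bounded, shows that `φ v / u` multiplies `L²` into itself.
-/

namespace WeightedSobolev

local notation "vol₊" => (volume.restrict (Ioi (0 : ℝ)) : Measure ℝ)

/-! ### Locally absolutely continuous functions -/

/-- `F` is locally absolutely continuous on `(0, ∞)` with a.e. derivative `h`. This is the everywhere
defined (continuous) counterpart of `IsWeakDeriv 1 F h`. -/
def HasACDeriv (F h : ℝ → ℝ) : Prop :=
  (∀ a b : ℝ, 0 < a → 0 < b → AbsolutelyContinuousOnInterval F a b) ∧
    ∀ᵐ x ∂vol₊, HasDerivAt F (h x) x

theorem HasACDeriv.congr_deriv {F h h' : ℝ → ℝ} (hF : HasACDeriv F h) (hh : h =ᵐ[vol₊] h') :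
    HasACDeriv F h' := by
  refine ⟨hF.1, ?_⟩
  filter_upwards [hF.2, hh] with x h1 h2
  rwa [← h2]

theorem HasACDeriv.congr {F G h : ℝ → ℝ} (hF : HasACDeriv F h) (hFG : EqOn F G (Ioi 0)) :
    HasACDeriv G h := by
  refine ⟨fun a b ha hb => ?_, ?_⟩
  · have hsub : ∀ x ∈ uIcc a b, F x = G x := fun x hx =>
      hFG (lt_of_lt_of_le (lt_min ha hb) hx.1)
    have h1 := hF.1 a b ha hb
    rw [absolutelyContinuousOnInterval_iff] at h1 ⊢
    intro ε hε
    obtain ⟨δ, hδ, h2⟩ := h1 ε hε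
    refine ⟨δ, hδ, fun E hE hlt => ?_⟩
    refine lt_of_eq_of_lt (Finset.sum_congr rfl fun i hi => ?_) (h2 E hE hlt)
    have h3 := hE.1 i (by simpa using hi)
    rw [hsub _ h3.1, hsub _ h3.2]
  · filter_upwards [hF.2, ae_restrict_mem measurableSet_Ioi] with x hx1 hx
    refine hx1.congr_of_eventuallyEq ?_
    exact (Filter.eventuallyEq_of_mem (isOpen_Ioi.mem_nhds hx) hFG).symm

theorem intervalIntegrable_of_locallyIntegrableOn {h : ℝ → ℝ}
    (hh : LocallyIntegrableOn h (Ioi (0 : ℝ))) {a b : ℝ} (ha : 0 < a) (hb : 0 < b) :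
    IntervalIntegrable h volume a b := by
  rw [intervalIntegrable_iff']
  refine hh.integrableOn_compact_subset ?_ isCompact_uIcc
  intro x hx
  exact lt_of_lt_of_le (lt_min ha hb) hx.1

theorem ae_halfLine_of_forall_nat {p : ℝ → Prop}
    (hp : ∀ n : ℕ, ∀ᵐ x ∂(volume : Measure ℝ), x ∈ Icc ((n + 1 : ℝ)⁻¹) (n + 1) → p x) :
    ∀ᵐ x ∂vol₊, p x := by
  rw [ae_restrict_iff' measurableSet_Ioi]
  filter_upwards [ae_all_iff.2 hp] with x hx hx0
  have hx0 : 0 < x := hx0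
  obtain ⟨n, hn⟩ := exists_nat_gt (max x x⁻¹)
  refine hx n ⟨?_, ?_⟩
  · rw [inv_le_comm₀ (by positivity) hx0]
    exact ((le_max_right x x⁻¹).trans hn.le).trans (by linarith)
  · exact ((le_max_left x x⁻¹).trans hn.le).trans (by linarith)

theorem hasACDeriv_integral {h : ℝ → ℝ} (hh : LocallyIntegrableOn h (Ioi (0 : ℝ))) (c : ℝ) :
    HasACDeriv (fun x => c + ∫ t in (1 : ℝ)..x, h t) h := by
  constructor
  · intro a b ha hb
    have hm : 0 < min (min a b) 1 := lt_min (lt_min ha hb) one_pos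
    have hM : 0 < max (max a b) 1 := lt_max_of_lt_right one_pos
    have h1 := (intervalIntegrable_of_locallyIntegrableOn hh hm
      hM).absolutelyContinuousOnInterval_intervalIntegral (c := 1) (by
        rw [uIcc_of_le ((min_le_right _ _).trans (le_max_right _ _))]
        exact ⟨min_le_right _ _, le_max_right _ _⟩)
    have h2 : AbsolutelyContinuousOnInterval (fun _ : ℝ => c) (min (min a b) 1)
        (max (max a b) 1) :=
      (contDiff_const.contDiffOn (n := 1)).absolutelyContinuousOnInterval
    refine (h2.add h1).mono (uIcc_subset_uIcc ?_ ?_)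
    all_goals
      rw [uIcc_of_le ((min_le_right _ _).trans (le_max_right _ _))]
      constructor <;> simp
  · refine ae_halfLine_of_forall_nat fun n => ?_
    have hn : (0 : ℝ) < (n + 1 : ℝ)⁻¹ := by positivity
    have h1 : (n + 1 : ℝ)⁻¹ ≤ 1 := inv_le_one_of_one_le₀ (by linarith [n.cast_nonneg (α := ℝ)])
    have h2 : (1 : ℝ) ≤ n + 1 := by linarith [n.cast_nonneg (α := ℝ)]
    filter_upwards [(intervalIntegrable_of_locallyIntegrableOn hh hn
      (by positivity : (0 : ℝ) < n + 1)).ae_hasDerivAt_integral] with x hx hxm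
    rw [uIcc_of_le (h1.trans h2)] at hx
    exact (hx hxm 1 ⟨h1, h2⟩).const_add c

theorem HasACDeriv.locallyIntegrableOn {F h : ℝ → ℝ} (hF : HasACDeriv F h) :
    LocallyIntegrableOn h (Ioi (0 : ℝ)) := by
  rw [locallyIntegrableOn_iff isOpen_Ioi.isLocallyClosed]
  intro K hK hKc
  rcases K.eq_empty_or_nonempty with rfl | hne
  · simp
  obtain ⟨a, haK, ha⟩ := hKc.exists_isLeast hne
  obtain ⟨b, hbK, hb⟩ := hKc.exists_isGreatest hne
  have hab : a ≤ b := ha hbK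
  have h1 := (hF.1 a b (hK haK) (hK hbK)).intervalIntegrable_deriv
  rw [intervalIntegrable_iff', uIcc_of_le hab] at h1
  have h2 : IntegrableOn h (Icc a b) := by
    refine h1.congr ?_
    have h3 := ae_restrict_of_ae_restrict_of_subset
      (fun x hx => lt_of_lt_of_le (hK haK) hx.1 : Icc a b ⊆ Ioi 0) hF.2
    filter_upwards [h3] with x hx using hx.deriv
  exact h2.mono_set fun x hx => ⟨ha hx, hb hx⟩

theorem HasACDeriv.eq_integral {F h : ℝ → ℝ} (hF : HasACDeriv F h) {a x : ℝ} (ha : 0 < a)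
    (hx : 0 < x) : F x = F a + ∫ t in a..x, h t := by
  have h1 := (hF.1 a x ha hx).integral_deriv_eq_sub
  have h2 : ∫ t in a..x, deriv F t = ∫ t in a..x, h t := by
    refine intervalIntegral.integral_congr_ae ?_
    have h3 := (ae_restrict_iff' measurableSet_Ioi).1 hF.2
    filter_upwards [h3] with t ht htm
    exact (ht ((lt_min ha hx).trans htm.1)).deriv
  linarith

theorem HasACDeriv.continuousOn {F h : ℝ → ℝ} (hF : HasACDeriv F h) :
    ContinuousOn F (Ioi (0 : ℝ)) := by
  intro x hx
  have hx : 0 < x := hx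
  have h1 := (hF.1 (x / 2) (2 * x) (by linarith) (by linarith)).continuousOn
  refine (h1.continuousAt ?_).continuousWithinAt
  rw [uIcc_of_le (by linarith)]
  exact Icc_mem_nhds (by linarith) (by linarith)

/-- Locally absolutely continuous functions that agree a.e. agree everywhere on `(0, ∞)`, so their
derivatives agree a.e.; this is what makes weak derivatives unique. -/
theorem HasACDeriv.ae_eq_of_ae_eq {F G h k : ℝ → ℝ} (hF : HasACDeriv F h) (hG : HasACDeriv G k)
    (hFG : F =ᵐ[vol₊] G) : h =ᵐ[vol₊] k := by
  have h1 : EqOn F G (Ioi 0) :=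
    Measure.eqOn_open_of_ae_eq hFG isOpen_Ioi hF.continuousOn hG.continuousOn
  filter_upwards [hF.2, hG.2, ae_restrict_mem measurableSet_Ioi] with x hx1 hx2 hx
  have h2 : F =ᶠ[nhds x] G := Filter.eventuallyEq_of_mem (isOpen_Ioi.mem_nhds hx) h1
  exact hx1.unique (hx2.congr_of_eventuallyEq h2)

theorem HasACDeriv.add {F G h k : ℝ → ℝ} (hF : HasACDeriv F h) (hG : HasACDeriv G k) :
    HasACDeriv (fun x => F x + G x) (fun x => h x + k x) := by
  refine ⟨fun a b ha hb => (hF.1 a b ha hb).add (hG.1 a b ha hb), ?_⟩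
  filter_upwards [hF.2, hG.2] with x h1 h2 using h1.add h2

theorem HasACDeriv.sub {F G h k : ℝ → ℝ} (hF : HasACDeriv F h) (hG : HasACDeriv G k) :
    HasACDeriv (fun x => F x - G x) (fun x => h x - k x) := by
  refine ⟨fun a b ha hb => (hF.1 a b ha hb).sub (hG.1 a b ha hb), ?_⟩
  filter_upwards [hF.2, hG.2] with x h1 h2 using h1.sub h2

theorem HasACDeriv.mul {F G h k : ℝ → ℝ} (hF : HasACDeriv F h) (hG : HasACDeriv G k) :
    HasACDeriv (fun x => F x * G x) (fun x => h x * G x + F x * k x) := by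
  refine ⟨fun a b ha hb => (hF.1 a b ha hb).mul (hG.1 a b ha hb), ?_⟩
  filter_upwards [hF.2, hG.2] with x h1 h2 using h1.mul h2

theorem hasACDeriv_of_contDiff {F : ℝ → ℝ} (hF : ContDiff ℝ 1 F) : HasACDeriv F (deriv F) :=
  ⟨fun _ _ _ _ => hF.contDiffOn.absolutelyContinuousOnInterval,
    ae_of_all _ fun x => (hF.differentiable one_ne_zero x).hasDerivAt⟩

theorem hasACDeriv_const (c : ℝ) : HasACDeriv (fun _ => c) (fun _ => 0) := by
  simpa using hasACDeriv_of_contDiff (contDiff_const (c := c))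

theorem HasACDeriv.const_mul {F h : ℝ → ℝ} (hF : HasACDeriv F h) (c : ℝ) :
    HasACDeriv (fun x => c * F x) (fun x => c * h x) := by
  simpa using (hasACDeriv_const c).mul hF

theorem HasACDeriv.sum {ι : Type*} {F h : ι → ℝ → ℝ} (s : Finset ι)
    (hF : ∀ i ∈ s, HasACDeriv (F i) (h i)) :
    HasACDeriv (fun x => ∑ i ∈ s, F i x) (fun x => ∑ i ∈ s, h i x) := by
  classical
  induction s using Finset.induction_on with
  | empty => simpa using hasACDeriv_const 0
  | insert a s ha ih =>
    simp only [Finset.sum_insert ha]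
    exact (hF a (by simp)).add (ih fun i hi => hF i (by simp [hi]))

/-! ### Weak derivatives as chains of absolutely continuous functions -/

/-- `F 0, F 1, …, F n` are successive derivatives on `(0, ∞)`: each is locally absolutely continuous
with a.e. derivative the next one. Only `F n` is determined merely up to a null set. -/
def IsDerivChain (n : ℕ) (F : ℕ → ℝ → ℝ) : Prop :=
  ∀ i < n, HasACDeriv (F i) (F (i + 1))

theorem IsWeakDeriv.congr {n : ℕ} {f f' g g' : ℝ → ℝ} (h : IsWeakDeriv n f g)
    (hf : f =ᵐ[vol₊] f') (hg : g =ᵐ[vol₊] g') : IsWeakDeriv n f' g' := by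
  induction n generalizing f f' with
  | zero => exact (hf.symm.trans h).trans hg
  | succ n ih =>
    obtain ⟨k, hk, ⟨c, hc⟩, hw⟩ := h
    exact ⟨k, hk, ⟨c, hf.symm.trans hc⟩, ih hw (Filter.EventuallyEq.refl _ _)⟩

theorem IsDerivChain.isWeakDeriv {n : ℕ} {F : ℕ → ℝ → ℝ} (hF : IsDerivChain n F) :
    IsWeakDeriv n (F 0) (F n) := by
  induction n generalizing F with
  | zero => exact Filter.EventuallyEq.refl _ _
  | succ n ih =>
    have h0 := hF 0 (Nat.succ_pos n)
    refine ⟨F 1, h0.locallyIntegrableOn, ⟨F 0 1, ?_⟩, ?_⟩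
    · filter_upwards [ae_restrict_mem measurableSet_Ioi] with x hx
      exact h0.eq_integral one_pos hx
    · exact ih (F := fun i => F (i + 1)) fun i hi => hF (i + 1) (by omega)

/-- Together with `IsDerivChain.isWeakDeriv` this says that a weak derivative of order `n` is the last
term of a derivative chain of length `n`, with continuous representatives in all lower orders. -/
theorem IsWeakDeriv.exists_chain {n : ℕ} {f g : ℝ → ℝ} (h : IsWeakDeriv n f g) :
    ∃ F : ℕ → ℝ → ℝ, IsDerivChain n F ∧ f =ᵐ[vol₊] F 0 ∧ F n =ᵐ[vol₊] g := by
  induction n generalizing f with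
  | zero => exact ⟨fun _ => f, fun i hi => absurd hi (by omega), Filter.EventuallyEq.refl _ _, h⟩
  | succ n ih =>
    obtain ⟨k, hk, ⟨c, hc⟩, hw⟩ := h
    obtain ⟨F, hF, h0, hn⟩ := ih hw
    refine ⟨fun i => Nat.casesOn i (fun x => c + ∫ t in (1 : ℝ)..x, k t) F, ?_, hc, hn⟩
    rintro (_ | i) hi
    · exact (hasACDeriv_integral hk c).congr_deriv h0
    · exact hF i (by omega)

theorem IsWeakDeriv.unique {n : ℕ} {f g g' : ℝ → ℝ} (h : IsWeakDeriv n f g)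
    (h' : IsWeakDeriv n f g') : g =ᵐ[vol₊] g' := by
  induction n generalizing f with
  | zero => exact (Filter.EventuallyEq.symm h).trans h'
  | succ n ih =>
    obtain ⟨k, hk, ⟨c, hc⟩, hw⟩ := h
    obtain ⟨k', hk', ⟨c', hc'⟩, hw'⟩ := h'
    have h1 := (hasACDeriv_integral hk c).ae_eq_of_ae_eq (hasACDeriv_integral hk' c')
      (hc.symm.trans hc')
    exact ih hw (hw'.congr h1.symm (Filter.EventuallyEq.refl _ _))

theorem IsWeakDeriv.sub {n : ℕ} {f₁ f₂ g₁ g₂ : ℝ → ℝ} (h₁ : IsWeakDeriv n f₁ g₁)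
    (h₂ : IsWeakDeriv n f₂ g₂) :
    IsWeakDeriv n (fun x => f₁ x - f₂ x) (fun x => g₁ x - g₂ x) := by
  obtain ⟨F, hF, hF0, hFn⟩ := h₁.exists_chain
  obtain ⟨G, hG, hG0, hGn⟩ := h₂.exists_chain
  have hc : IsDerivChain n fun i x => F i x - G i x := fun i hi => (hF i hi).sub (hG i hi)
  exact hc.isWeakDeriv.congr (hF0.symm.sub hG0.symm) (hFn.sub hGn)

/-- The Leibniz rule. -/
theorem IsDerivChain.mul {n : ℕ} {F G : ℕ → ℝ → ℝ} (hF : IsDerivChain n F)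
    (hG : IsDerivChain n G) :
    IsDerivChain n fun j x =>
      ∑ p ∈ Finset.HasAntidiagonal.antidiagonal j, (j.choose p.1 : ℝ) * (F p.1 x * G p.2 x) := by
  intro j hj
  have h1 := HasACDeriv.sum (Finset.HasAntidiagonal.antidiagonal j)
    (F := fun p x => (j.choose p.1 : ℝ) * (F p.1 x * G p.2 x)) fun p hp => by
      have hp' := Finset.HasAntidiagonal.mem_antidiagonal.1 hp
      exact ((hF p.1 (by omega)).mul (hG p.2 (by omega))).const_mul (j.choose p.1 : ℝ)
  refine h1.congr_deriv (ae_of_all _ fun x => ?_)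
  have h2 := Finset.sum_antidiagonal_choose_succ_nsmul (fun a b => F a x * G b x) j
  simp only [nsmul_eq_mul] at h2
  simp only []
  rw [h2, ← Finset.sum_add_distrib]
  refine Finset.sum_congr rfl fun p hp => ?_
  rw [← Finset.HasAntidiagonal.mem_antidiagonal.1 hp]
  have h3 : (p.1 + p.2).choose p.2 = (p.1 + p.2).choose p.1 := by
    rw [← Nat.choose_symm_add]
  simp only [h3]
  ring

/-! ### Variation of parameters and the derivatives of a product -/

theorem isDerivChain_pow (k n : ℕ) :
    IsDerivChain n fun j x => (k.descFactorial j : ℝ) * x ^ (k - j) := by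
  intro j _
  have h1 : ContDiff ℝ 1 fun x : ℝ => (k.descFactorial j : ℝ) * x ^ (k - j) := by fun_prop
  refine (hasACDeriv_of_contDiff h1).congr_deriv (ae_of_all _ fun x => ?_)
  have h2 := ((hasDerivAt_pow (k - j) x).const_mul (k.descFactorial j : ℝ)).deriv
  simp only []
  rw [h2, Nat.descFactorial_succ, Nat.sub_sub]
  push_cast
  ring

/-- The coefficient `a_k` in `f x = ∑_{k<n} a_k(x) x^k / k!`, where `f^{(n)} = g`: variation of
parameters for the equation `f^{(n)} = g` in the fundamental system `x^k / k!`, with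
`a_k(0) = α k` and `a_k'(x) = g(x) (-x)^{n-1-k} / (n-1-k)!`. Used for `k < n` only. -/
noncomputable def taylorCoeff (n : ℕ) (α : ℕ → ℝ) (g : ℝ → ℝ) (k : ℕ) (x : ℝ) : ℝ :=
  α k + ∫ t in (0 : ℝ)..x, g t * ((-t) ^ (n - 1 - k) / ((n - 1 - k).factorial : ℝ))

/-- The `j`-th derivative of `∑_{k<n} a_k(x) x^k / k!` for `j ≤ n`. By the choice of the `a_k` it is
obtained by differentiating the monomials alone when `j < n`; for `j = n` the sum vanishes and the
derivative is `g`. The factor `k.descFactorial j` kills the terms with `k < j`, where `k - j`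
truncates. -/
noncomputable def taylorChain (n : ℕ) (α : ℕ → ℝ) (g : ℝ → ℝ) (j : ℕ) (x : ℝ) : ℝ :=
  (∑ k ∈ Finset.range n, taylorCoeff n α g k x / (k.factorial : ℝ) *
    ((k.descFactorial j : ℝ) * x ^ (k - j))) + if j = n then g x else 0

/-- The `j`-th derivative in `y` of `(y - x) ^ (n - 1) / (n - 1)!` at `y = x`: the contributions of the
derivatives of the coefficients `a_k` cancel until the last step. -/
theorem sum_neg_pow_div_factorial {n j : ℕ} (hj : j < n) (x : ℝ) :
    ∑ k ∈ Finset.range n, (-x) ^ (n - 1 - k) / ((n - 1 - k).factorial : ℝ) / (k.factorial : ℝ) *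
      ((k.descFactorial j : ℝ) * x ^ (k - j)) = if j + 1 = n then 1 else 0 := by
  obtain ⟨d, rfl⟩ : ∃ d, n = j + (d + 1) := ⟨n - 1 - j, by omega⟩
  rw [Finset.sum_range_add, Finset.sum_eq_zero, zero_add]
  · have h1 : ∀ i ∈ Finset.range (d + 1),
        (-x) ^ (j + (d + 1) - 1 - (j + i)) / ((j + (d + 1) - 1 - (j + i)).factorial : ℝ) /
          ((j + i).factorial : ℝ) * (((j + i).descFactorial j : ℝ) * x ^ (j + i - j)) =
        (x ^ i * (-x) ^ (d - i) * (d.choose i : ℝ)) / (d.factorial : ℝ) := by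
      intro i hi
      have hi : i ≤ d := by simpa [Nat.lt_succ_iff] using hi
      have e1 : j + (d + 1) - 1 - (j + i) = d - i := by omega
      have e2 : j + i - j = i := by omega
      have e3 := Nat.factorial_mul_descFactorial (Nat.le_add_right j i)
      have e4 := Nat.choose_mul_factorial_mul_factorial hi
      rw [e2] at e3
      rw [e1, e2, ← e3, ← e4]
      have p1 : (i.factorial : ℝ) ≠ 0 := by positivity
      have p2 : ((d - i).factorial : ℝ) ≠ 0 := by positivity
      have p3 : ((j + i).descFactorial j : ℝ) ≠ 0 := by
        have := Nat.descFactorial_pos.2 (Nat.le_add_right j i)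
        positivity
      have p4 : (d.choose i : ℝ) ≠ 0 := by
        have := Nat.choose_pos hi
        positivity
      push_cast
      field_simp
    rw [Finset.sum_congr rfl h1, ← Finset.sum_div, ← add_pow]
    rcases Nat.eq_zero_or_pos d with rfl | hd
    · simp
    · rw [add_neg_cancel, zero_pow hd.ne', if_neg (by omega), zero_div]
  · intro k hk
    rw [Nat.descFactorial_of_lt (by simpa using hk)]
    simp

theorem intervalIntegrable_moment {g : ℝ → ℝ} (hg : ∀ r : ℝ, 0 < r → IntegrableOn g (Ioo 0 r))
    (n k : ℕ) {a b : ℝ} (ha : 0 ≤ a) (hb : 0 ≤ b) :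
    IntervalIntegrable (fun t => g t * ((-t) ^ (n - 1 - k) / ((n - 1 - k).factorial : ℝ)))
      volume a b := by
  have h1 : IntervalIntegrable g volume a b := by
    rw [intervalIntegrable_iff]
    have h2 : IntegrableOn g (Ioc 0 (max a b + 1)) := by
      rw [integrableOn_Ioc_iff_integrableOn_Ioo]
      exact hg _ (by positivity)
    refine h2.mono_set fun x hx => ⟨lt_of_le_of_lt (le_min ha hb) hx.1, hx.2.trans ?_⟩
    linarith [le_refl (max a b)]
  exact h1.mul_continuousOn (by fun_prop)

theorem hasACDeriv_taylorCoeff {g : ℝ → ℝ} (hg : ∀ r : ℝ, 0 < r → IntegrableOn g (Ioo 0 r))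
    (n : ℕ) (α : ℕ → ℝ) (k : ℕ) :
    HasACDeriv (taylorCoeff n α g k)
      (fun x => g x * ((-x) ^ (n - 1 - k) / ((n - 1 - k).factorial : ℝ))) := by
  set G : ℝ → ℝ := fun t => g t * ((-t) ^ (n - 1 - k) / ((n - 1 - k).factorial : ℝ)) with hG
  have hint := fun {a b : ℝ} (ha : 0 ≤ a) (hb : 0 ≤ b) =>
    intervalIntegrable_moment hg n k ha hb
  have hloc : LocallyIntegrableOn G (Ioi 0) := by
    rw [locallyIntegrableOn_iff isOpen_Ioi.isLocallyClosed]
    intro K hK hKc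
    obtain ⟨b, hb⟩ := hKc.bddAbove
    have h1 := hint le_rfl (le_max_right b 0)
    rw [intervalIntegrable_iff, uIoc_of_le (le_max_right b 0)] at h1
    exact h1.mono_set fun x hx => ⟨hK hx, (hb hx).trans (le_max_left _ _)⟩
  have h2 := hasACDeriv_integral hloc (α k + ∫ t in (0 : ℝ)..1, G t)
  have heq : EqOn (fun x => (α k + ∫ t in (0 : ℝ)..1, G t) + ∫ t in (1 : ℝ)..x, G t)
      (taylorCoeff n α g k) (Ioi 0) := by
    intro x hx
    have hx : 0 < x := hx
    simp only [taylorCoeff]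
    rw [add_assoc, intervalIntegral.integral_add_adjacent_intervals (hint le_rfl zero_le_one)
      (hint zero_le_one hx.le)]
  exact h2.congr heq

theorem isDerivChain_taylorChain {g : ℝ → ℝ} (hg : ∀ r : ℝ, 0 < r → IntegrableOn g (Ioo 0 r))
    (n : ℕ) (α : ℕ → ℝ) : IsDerivChain n (taylorChain n α g) := by
  intro j hj
  have h1 := HasACDeriv.sum (Finset.range n) fun k _ =>
    ((hasACDeriv_taylorCoeff hg n α k).const_mul ((k.factorial : ℝ)⁻¹)).mul
      (isDerivChain_pow k n j hj)
  have h2 : taylorChain n α g j = fun x => ∑ k ∈ Finset.range n,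
      ((k.factorial : ℝ)⁻¹ * taylorCoeff n α g k x) *
        ((k.descFactorial j : ℝ) * x ^ (k - j)) := by
    funext x
    simp only [taylorChain, if_neg hj.ne, add_zero]
    exact Finset.sum_congr rfl fun k _ => by ring
  rw [h2]
  refine h1.congr_deriv (ae_of_all _ fun x => ?_)
  have h3 := sum_neg_pow_div_factorial hj x
  have h4 : (if j + 1 = n then g x else 0) = g x * (if j + 1 = n then 1 else 0) := by
    split_ifs <;> simp
  simp only [taylorChain]
  rw [h4, ← h3, Finset.mul_sum, ← Finset.sum_add_distrib]
  refine Finset.sum_congr rfl fun k _ => ?_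
  ring

theorem taylorChain_self {n : ℕ} (α : ℕ → ℝ) (g : ℝ → ℝ) : taylorChain n α g n = g := by
  funext x
  simp only [taylorChain, if_true]
  rw [Finset.sum_eq_zero, zero_add]
  intro k hk
  rw [Nat.descFactorial_of_lt (by simpa using hk)]
  simp

theorem isWeakDeriv_taylorChain {g : ℝ → ℝ} (hg : ∀ r : ℝ, 0 < r → IntegrableOn g (Ioo 0 r))
    (n : ℕ) (α : ℕ → ℝ) : IsWeakDeriv n (taylorChain n α g 0) g := by
  have h := (isDerivChain_taylorChain hg n α).isWeakDeriv
  rwa [taylorChain_self] at h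

theorem continuousOn_taylorChain {g : ℝ → ℝ} (hg : ∀ r : ℝ, 0 < r → IntegrableOn g (Ioo 0 r))
    {n : ℕ} (hn : 1 ≤ n) (α : ℕ → ℝ) : ContinuousOn (taylorChain n α g 0) (Icc 0 1) := by
  have h1 : ∀ k, ContinuousOn (taylorCoeff n α g k) (Icc 0 1) := by
    intro k
    have h2 := intervalIntegrable_moment hg n k le_rfl zero_le_one
    rw [intervalIntegrable_iff'] at h2
    have h3 := intervalIntegral.continuousOn_primitive_interval h2
    rw [uIcc_of_le zero_le_one] at h3
    exact continuousOn_const.add h3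
  have h4 : taylorChain n α g 0 = fun x => ∑ k ∈ Finset.range n,
      taylorCoeff n α g k x / (k.factorial : ℝ) * ((k.descFactorial 0 : ℝ) * x ^ (k - 0)) := by
    funext x
    simp only [taylorChain, if_neg (show (0 : ℕ) ≠ n by omega), add_zero]
  rw [h4]
  refine continuousOn_finsetSum _ fun k _ => ?_
  exact ((h1 k).div_const _).mul (by fun_prop)

/-- A function with vanishing `n`-th weak derivative is a polynomial of degree less than `n`. -/
theorem IsWeakDeriv.exists_eq_polynomial {n : ℕ} {f : ℝ → ℝ} (h : IsWeakDeriv n f fun _ => 0) :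
    ∃ α : ℕ → ℝ, f =ᵐ[vol₊] fun x => ∑ k ∈ Finset.range n, α k * (x ^ k / (k.factorial : ℝ)) := by
  induction n generalizing f with
  | zero => exact ⟨0, by simpa [IsWeakDeriv] using h⟩
  | succ n ih =>
    obtain ⟨k, hk, ⟨c, hc⟩, hw⟩ := h
    obtain ⟨β, hβ⟩ := ih hw
    have h1 := HasACDeriv.sum (Finset.range n) fun i _ =>
      (hasACDeriv_of_contDiff (F := fun x : ℝ => x ^ (i + 1) / ((i + 1).factorial : ℝ))
        (by fun_prop)).const_mul (β i)
    have h2 := ((hasACDeriv_integral hk c).congr_deriv hβ).sub h1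
    have h3 := h2.congr_deriv (h' := fun _ => 0) (ae_of_all _ fun x => by
      simp only []
      rw [← Finset.sum_sub_distrib]
      refine Finset.sum_eq_zero fun i _ => ?_
      have h4 := ((hasDerivAt_pow (i + 1) x).div_const ((i + 1).factorial : ℝ)).deriv
      rw [h4, Nat.factorial_succ]
      have : ((i : ℝ) + 1) ≠ 0 := by positivity
      have : (i.factorial : ℝ) ≠ 0 := by positivity
      push_cast
      field_simp
      ring)
    set b : ℝ := (c + ∫ t in (1 : ℝ)..1, k t) - ∑ i ∈ Finset.range n,
      β i * ((1 : ℝ) ^ (i + 1) / ((i + 1).factorial : ℝ)) with hb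
    refine ⟨fun i => if i = 0 then b else β (i - 1), ?_⟩
    filter_upwards [hc, ae_restrict_mem measurableSet_Ioi] with x hx hx0
    have h5 := h3.eq_integral one_pos hx0
    rw [hx, Finset.sum_range_succ']
    simp only [intervalIntegral.integral_zero, add_zero] at h5
    simp only [pow_zero, Nat.factorial_zero, Nat.cast_one, div_one, mul_one, if_true,
      Nat.succ_ne_zero, if_false, Nat.add_sub_cancel]
    simp only [intervalIntegral.integral_same, add_zero] at h5 hb
    linarith

theorem taylorChain_eq_add (n : ℕ) (α : ℕ → ℝ) (g : ℝ → ℝ) (x : ℝ) :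
    taylorChain n α g 0 x =
      taylorChain n 0 g 0 x + ∑ k ∈ Finset.range n, α k * (x ^ k / (k.factorial : ℝ)) := by
  simp only [taylorChain, taylorCoeff, Pi.zero_apply, zero_add]
  rw [add_right_comm, ← Finset.sum_add_distrib]
  congr 1
  refine Finset.sum_congr rfl fun k _ => ?_
  simp only [Nat.descFactorial_zero, Nat.cast_one, one_mul, Nat.sub_zero]
  ring

/-- Every function whose `n`-th weak derivative `g` is integrable up to `0` is given by variation of
parameters; the `α k` are its Taylor coefficients at `0`. -/
theorem IsWeakDeriv.exists_eq_taylorChain {n : ℕ} {f g : ℝ → ℝ} (h : IsWeakDeriv n f g)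
    (hg : ∀ r : ℝ, 0 < r → IntegrableOn g (Ioo 0 r)) :
    ∃ α : ℕ → ℝ, f =ᵐ[vol₊] taylorChain n α g 0 := by
  have h1 := (h.sub (isWeakDeriv_taylorChain hg n 0)).congr (Filter.EventuallyEq.refl _ _)
    (g' := fun _ => 0) (ae_of_all _ fun x => sub_self (g x))
  obtain ⟨α, hα⟩ := h1.exists_eq_polynomial
  refine ⟨α, ?_⟩
  filter_upwards [hα] with x hx
  rw [taylorChain_eq_add, ← hx]
  ring

/-- The `m`-th derivative of `φ f`, where `f = ∑_{k<l} a_k(x) x^k / k!`, `f^{(l)} = g`, and `D k` is the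
`m`-th derivative of `φ x^k`: the coefficients `a_k` are differentiated only when `m = l`. -/
noncomputable def productDeriv (l m : ℕ) (φ : ℝ → ℝ) (D : ℕ → ℝ → ℝ) (α : ℕ → ℝ) (g : ℝ → ℝ)
    (x : ℝ) : ℝ :=
  (∑ k ∈ Finset.range l, taylorCoeff l α g k x / (k.factorial : ℝ) * D k x) +
    if m = l then φ x * g x else 0

/-- The key formula `(φ f)^{(m)} = ∑_{k<l} a_k (φ x^k)^{(m)} / k!` (plus `φ f^{(l)}` if `m = l`). The
Leibniz rule expresses both sides through the derivatives of `φ`, and the derivatives of `f` of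
order less than `l` act only on the monomials. -/
theorem isWeakDeriv_mul_taylorChain {l m : ℕ} (hml : m ≤ l) (hl : 1 ≤ l) {φ g : ℝ → ℝ}
    {D : ℕ → ℝ → ℝ} (hD : ∀ k < l, IsWeakDeriv m (fun x => φ x * x ^ k) (D k))
    (hg : ∀ r : ℝ, 0 < r → IntegrableOn g (Ioo 0 r)) (α : ℕ → ℝ) :
    IsWeakDeriv m (fun x => φ x * taylorChain l α g 0 x) (productDeriv l m φ D α g) := by
  have h0 : IsWeakDeriv m φ (D 0) := by simpa using hD 0 hl
  obtain ⟨Φ, hΦ, hΦ0, -⟩ := h0.exists_chain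
  have hR : IsDerivChain m (taylorChain l α g) := fun j hj =>
    isDerivChain_taylorChain hg l α j (by omega)
  have hDk : ∀ k ∈ Finset.range l, D k =ᵐ[vol₊] fun x =>
      ∑ p ∈ Finset.HasAntidiagonal.antidiagonal m,
        (m.choose p.1 : ℝ) * (Φ p.1 x * ((k.descFactorial p.2 : ℝ) * x ^ (k - p.2))) := by
    intro k hk
    have h1 := (hΦ.mul (isDerivChain_pow k m)).isWeakDeriv
    refine (hD k (by simpa using hk)).unique (h1.congr ?_ (Filter.EventuallyEq.refl _ _))
    filter_upwards [hΦ0] with x hx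
    simp [hx]
  refine (hΦ.mul hR).isWeakDeriv.congr ?_ ?_
  · filter_upwards [hΦ0] with x hx
    simp [hx]
  · have hDk' := (Finset.eventually_all (Finset.range l)).2 hDk
    filter_upwards [hΦ0, hDk'] with x hx hx'
    have h2 : ∑ k ∈ Finset.range l, taylorCoeff l α g k x / (k.factorial : ℝ) * D k x =
        ∑ p ∈ Finset.HasAntidiagonal.antidiagonal m, (m.choose p.1 : ℝ) * (Φ p.1 x *
          ∑ k ∈ Finset.range l, taylorCoeff l α g k x / (k.factorial : ℝ) *
            ((k.descFactorial p.2 : ℝ) * x ^ (k - p.2))) := by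
      rw [Finset.sum_congr rfl fun k hk => by rw [hx' k hk]]
      simp only [Finset.mul_sum]
      rw [Finset.sum_comm]
      refine Finset.sum_congr rfl fun p _ => Finset.sum_congr rfl fun k _ => ?_
      ring
    have h3 : (if m = l then φ x * g x else 0) =
        ∑ p ∈ Finset.HasAntidiagonal.antidiagonal m, (m.choose p.1 : ℝ) * (Φ p.1 x *
          if p.2 = l then g x else 0) := by
      rw [Finset.sum_eq_single (0, m)]
      · split_ifs <;> simp [hx]
      · rintro ⟨i, j⟩ hp hne
        have hp := Finset.HasAntidiagonal.mem_antidiagonal.1 hp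
        simp only at hp
        have : j ≠ l := by
          rintro rfl
          exact hne (by ext <;> simp <;> omega)
        simp [this]
      · intro h
        exact absurd (Finset.HasAntidiagonal.mem_antidiagonal.2 (by simp)) h
    rw [productDeriv, h2, h3, ← Finset.sum_add_distrib]
    refine Finset.sum_congr rfl fun p _ => ?_
    simp only [taylorChain]
    ring

/-! ### The weighted Hardy inequality -/

theorem measurable_measure_Iio (σ : Measure ℝ) : Measurable fun t => σ (Iio t) :=
  Monotone.measurable fun _ _ h => measure_mono (Iio_subset_Iio h)

theorem measurable_measure_Ioi (σ : Measure ℝ) : Measurable fun t => σ (Ioi t) :=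
  Antitone.measurable fun _ _ h => measure_mono (Ioi_subset_Ioi h)

/-- The distribution function `N t = σ (-∞, t)` of an atomless measure satisfies `σ {N < y} ≤ y`: by
inner regularity it is enough to look at a compact subset, which lies to the left of its maximum. -/
theorem measure_measure_Iio_lt_le (σ : Measure ℝ) [IsFiniteMeasure σ] [NullSingletonClass σ] (y : ℝ≥0∞) :
    σ {t | σ (Iio t) < y} ≤ y := by
  have hS : MeasurableSet {t | σ (Iio t) < y} :=
    measurableSet_lt (measurable_measure_Iio σ) measurable_const
  rw [hS.measure_eq_iSup_isCompact]
  refine iSup_le fun K => iSup_le fun hKS => iSup_le fun hK => ?_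
  rcases K.eq_empty_or_nonempty with rfl | hne
  · simp
  obtain ⟨k, hk, hmax⟩ := hK.exists_isGreatest hne
  calc σ K ≤ σ (Iic k) := measure_mono fun x hx => hmax hx
    _ = σ (Iio k) := measure_congr Iio_ae_eq_Iic.symm
    _ ≤ y := (hKS hk).le

theorem measure_measure_Ioi_lt_le (σ : Measure ℝ) [IsFiniteMeasure σ] [NullSingletonClass σ] (y : ℝ≥0∞) :
    σ {t | σ (Ioi t) < y} ≤ y := by
  have hS : MeasurableSet {t | σ (Ioi t) < y} :=
    measurableSet_lt (measurable_measure_Ioi σ) measurable_const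
  rw [hS.measure_eq_iSup_isCompact]
  refine iSup_le fun K => iSup_le fun hKS => iSup_le fun hK => ?_
  rcases K.eq_empty_or_nonempty with rfl | hne
  · simp
  obtain ⟨k, hk, hmin⟩ := hK.exists_isLeast hne
  calc σ K ≤ σ (Ici k) := measure_mono fun x hx => hmin hx
    _ = σ (Ioi k) := measure_congr Ioi_ae_eq_Ici.symm
    _ ≤ y := (hKS hk).le

theorem sqrt_mul_self_ennreal (a : ℝ≥0∞) : a ^ (1 / 2 : ℝ) * a ^ (1 / 2 : ℝ) = a := by
  rw [← ENNReal.rpow_add_of_nonneg _ _ (by norm_num) (by norm_num)]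
  norm_num

theorem lintegral_Ioi_min_inv_sq_le {M : ℝ≥0∞} (hM : M ≠ ∞) :
    ∫⁻ s in Ioi (0 : ℝ), min M ((ENNReal.ofReal s)⁻¹ ^ 2) ≤ 2 * M ^ (1 / 2 : ℝ) := by
  rcases eq_or_ne M 0 with rfl | hM0
  · simp
  have hm : 0 < M.toReal := ENNReal.toReal_pos hM0 hM
  set c : ℝ := (√M.toReal)⁻¹ with hc
  have hc0 : 0 < c := by positivity
  have hsq : M ^ (1 / 2 : ℝ) = ENNReal.ofReal (√M.toReal) := by
    rw [Real.sqrt_eq_rpow, ← ENNReal.ofReal_rpow_of_pos hm, ENNReal.ofReal_toReal hM]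
  have h1 : ∫⁻ s in Ioc (0 : ℝ) c, min M ((ENNReal.ofReal s)⁻¹ ^ 2) ≤ M ^ (1 / 2 : ℝ) := by
    calc ∫⁻ s in Ioc (0 : ℝ) c, min M ((ENNReal.ofReal s)⁻¹ ^ 2)
        ≤ ∫⁻ _ in Ioc (0 : ℝ) c, M := lintegral_mono fun s => min_le_left _ _
      _ = M * ENNReal.ofReal c := by simp
      _ = ENNReal.ofReal (M.toReal * c) := by
        rw [ENNReal.ofReal_mul hm.le, ENNReal.ofReal_toReal hM]
      _ = M ^ (1 / 2 : ℝ) := by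
        rw [hsq, hc, ← div_eq_mul_inv, Real.div_sqrt]
  have h2 : ∫⁻ s in Ioi c, min M ((ENNReal.ofReal s)⁻¹ ^ 2) ≤ M ^ (1 / 2 : ℝ) := by
    calc ∫⁻ s in Ioi c, min M ((ENNReal.ofReal s)⁻¹ ^ 2)
        ≤ ∫⁻ s in Ioi c, ENNReal.ofReal (s ^ (-2 : ℝ)) := by
          refine setLIntegral_mono' measurableSet_Ioi fun s hs => (min_le_right _ _).trans ?_
          have hs0 : 0 < s := hc0.trans hs
          rw [← ENNReal.ofReal_inv_of_pos hs0, ← ENNReal.ofReal_pow (by positivity),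
            Real.rpow_neg hs0.le, inv_pow]
          norm_cast
      _ = ENNReal.ofReal (∫ s in Ioi c, s ^ (-2 : ℝ)) := by
          rw [ofReal_integral_eq_lintegral_ofReal (integrableOn_Ioi_rpow_of_lt (by norm_num) hc0)]
          filter_upwards [ae_restrict_mem measurableSet_Ioi] with s hs
          exact Real.rpow_nonneg (hc0.trans hs).le _
      _ = M ^ (1 / 2 : ℝ) := by
          rw [integral_Ioi_rpow_of_lt (by norm_num) hc0, hsq]
          congr 1
          norm_num
          rw [Real.rpow_neg hc0.le, Real.rpow_one, hc, inv_inv]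
  rw [← Ioc_union_Ioi_eq_Ioi hc0.le, lintegral_union measurableSet_Ioi
    (Ioc_disjoint_Ioi le_rfl), two_mul]
  exact add_le_add h1 h2

/-- A layer-cake form of `∫ dN / √N ≤ 2 √N`, which needs only that `σ {N < y} ≤ y`. -/
theorem lintegral_inv_sqrt_le (σ : Measure ℝ) [IsFiniteMeasure σ] {N : ℝ → ℝ≥0∞}
    (hN : Measurable N) (hσ : ∀ y, σ {t | N t < y} ≤ y) :
    ∫⁻ t, (N t ^ (1 / 2 : ℝ))⁻¹ ∂σ ≤ 2 * σ univ ^ (1 / 2 : ℝ) := by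
  have h0 : ∀ᵐ t ∂σ, N t ≠ 0 := by
    rw [ae_iff]
    refine le_antisymm (le_of_forall_pos_le_add fun ε hε => ?_) zero_le
    rw [zero_add]
    refine (measure_mono fun t ht => ?_).trans (hσ ε)
    simp only [ne_eq, not_not, mem_ofPred_eq] at ht ⊢
    rwa [ht]
  set f : ℝ → ℝ := fun t => ((N t ^ (1 / 2 : ℝ))⁻¹).toReal with hf
  have hfm : Measurable f := ((hN.pow_const _).inv).ennreal_toReal
  calc ∫⁻ t, (N t ^ (1 / 2 : ℝ))⁻¹ ∂σ = ∫⁻ t, ENNReal.ofReal (f t) ∂σ := by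
        refine lintegral_congr_ae ?_
        filter_upwards [h0] with t ht
        rw [hf, ENNReal.ofReal_toReal]
        simp [ht]
    _ = ∫⁻ s in Ioi (0 : ℝ), σ {t | s < f t} :=
        lintegral_eq_lintegral_meas_lt σ (ae_of_all _ fun t => ENNReal.toReal_nonneg)
          hfm.aemeasurable
    _ ≤ ∫⁻ s in Ioi (0 : ℝ), min (σ univ) ((ENNReal.ofReal s)⁻¹ ^ 2) := by
        refine setLIntegral_mono' measurableSet_Ioi fun s hs => ?_
        refine le_min (measure_mono (subset_univ _)) ((measure_mono fun t ht => ?_).trans (hσ _))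
        have hs : 0 < s := hs
        have ht : s < ((N t ^ (1 / 2 : ℝ))⁻¹).toReal := ht
        have h1 : ENNReal.ofReal s < (N t ^ (1 / 2 : ℝ))⁻¹ :=
          ENNReal.ofReal_lt_iff_lt_toReal hs.le (fun h => by
            rw [h] at ht; exact absurd ht (by simpa using hs.le)) |>.2 ht
        have h2 := ENNReal.lt_inv_iff_lt_inv.1 h1
        have h3 := ENNReal.rpow_lt_rpow h2 (show (0 : ℝ) < 2 by norm_num)
        rw [← ENNReal.rpow_mul] at h3
        simpa using h3
    _ ≤ 2 * σ univ ^ (1 / 2 : ℝ) := lintegral_Ioi_min_inv_sq_le (measure_ne_top _ _)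

theorem sq_lintegral_mul_le {μ : Measure ℝ} {f g : ℝ → ℝ≥0∞} (hf : AEMeasurable f μ)
    (hg : AEMeasurable g μ) :
    (∫⁻ t, f t * g t ∂μ) ^ 2 ≤ (∫⁻ t, f t ^ 2 ∂μ) * ∫⁻ t, g t ^ 2 ∂μ := by
  have h1 := ENNReal.lintegral_mul_le_Lp_mul_Lq μ Real.HolderConjugate.two_two hf hg
  simp only [Pi.mul_apply, ENNReal.rpow_ofNat] at h1
  calc (∫⁻ t, f t * g t ∂μ) ^ 2
      ≤ ((∫⁻ t, f t ^ 2 ∂μ) ^ (1 / 2 : ℝ) * (∫⁻ t, g t ^ 2 ∂μ) ^ (1 / 2 : ℝ)) ^ 2 := by gcongr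
    _ = _ := by
      rw [mul_pow, sq, sq, sqrt_mul_self_ennreal, sqrt_mul_self_ennreal]

theorem lintegral_Iio_inv_sqrt_le (σ : Measure ℝ) [NullSingletonClass σ] {x : ℝ} (hx : σ (Iio x) ≠ ∞) :
    ∫⁻ t in Iio x, (σ (Iio t) ^ (1 / 2 : ℝ))⁻¹ ∂σ ≤ 2 * σ (Iio x) ^ (1 / 2 : ℝ) := by
  have : IsFiniteMeasure (σ.restrict (Iio x)) := ⟨by simpa using hx.lt_top⟩
  have h1 := lintegral_inv_sqrt_le (σ.restrict (Iio x)) (measurable_measure_Iio _)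
    (measure_measure_Iio_lt_le _)
  rw [Measure.restrict_apply_univ] at h1
  refine le_trans (setLIntegral_mono' measurableSet_Iio fun t ht => ?_) h1
  rw [Measure.restrict_apply measurableSet_Iio, inter_eq_left.2 (Iio_subset_Iio (le_of_lt ht))]

theorem lintegral_Ioi_inv_sqrt_le (σ : Measure ℝ) [NullSingletonClass σ] {x : ℝ} (hx : σ (Ioi x) ≠ ∞) :
    ∫⁻ t in Ioi x, (σ (Ioi t) ^ (1 / 2 : ℝ))⁻¹ ∂σ ≤ 2 * σ (Ioi x) ^ (1 / 2 : ℝ) := by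
  have : IsFiniteMeasure (σ.restrict (Ioi x)) := ⟨by simpa using hx.lt_top⟩
  have h1 := lintegral_inv_sqrt_le (σ.restrict (Ioi x)) (measurable_measure_Ioi _)
    (measure_measure_Ioi_lt_le _)
  rw [Measure.restrict_apply_univ] at h1
  refine le_trans (setLIntegral_mono' measurableSet_Ioi fun t ht => ?_) h1
  rw [Measure.restrict_apply measurableSet_Ioi, inter_eq_left.2 (Ioi_subset_Ioi (le_of_lt ht))]

/-- The Hardy inequality for measurable functions. With `Q(x) = ∫_0^x q²` and `R(x) = ∫_x^∞ W²`, one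
applies the Cauchy–Schwarz inequality with the weight `Q^{1/4}`, exchanges the integrals, and uses
`√Q √R ≤ A` twice, once in the tail integral `∫_t^∞ W² √Q ≤ A ∫_t^∞ W² / √R ≤ 2 A √R(t)`. -/
theorem lintegral_hardy_of_measurable {W q h : ℝ → ℝ≥0∞} (hW : Measurable W) (hq : Measurable q)
    (hh : Measurable h) {A : ℝ≥0∞} (hA0 : A ≠ 0) (hA : A ≠ ∞)
    (hq0 : ∀ x : ℝ, 0 < x → ∫⁻ t in Ioo 0 x, q t ^ 2 ≠ 0)
    (hqfin : ∀ x : ℝ, 0 < x → ∫⁻ t in Ioo 0 x, q t ^ 2 ≠ ∞)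
    (hWfin : ∫⁻ t in Ioi 0, W t ^ 2 ≠ ∞)
    (hWq : ∀ x : ℝ, 0 < x → (∫⁻ t in Ioi x, W t ^ 2) * ∫⁻ t in Ioo 0 x, q t ^ 2 ≤ A ^ 2) :
    ∫⁻ x in Ioi (0 : ℝ), (W x * ∫⁻ t in Ioo 0 x, q t * h t) ^ 2 ≤
      4 * A ^ 2 * ∫⁻ t in Ioi (0 : ℝ), h t ^ 2 := by
  set σ : Measure ℝ := vol₊.withDensity fun t => q t ^ 2 with hσ
  set τ : Measure ℝ := vol₊.withDensity fun t => W t ^ 2 with hτ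
  have hrestr : ∀ x : ℝ, vol₊.restrict (Iio x) = volume.restrict (Ioo 0 x) := fun x => by
    rw [Measure.restrict_restrict measurableSet_Iio, inter_comm, Ioi_inter_Iio]
  have hrestr' : ∀ x : ℝ, 0 < x → vol₊.restrict (Ioi x) = volume.restrict (Ioi x) := fun x hx => by
    rw [Measure.restrict_restrict measurableSet_Ioi,
      inter_eq_left.2 (Ioi_subset_Ioi hx.le)]
  have hden : ∀ {g f : ℝ → ℝ≥0∞} {S : Set ℝ}, Measurable g → Measurable f → MeasurableSet S →
      ∫⁻ t in S, f t ∂(vol₊.withDensity g) = ∫⁻ t in S, g t * f t ∂vol₊ := fun hg hf hS =>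
    setLIntegral_withDensity_eq_setLIntegral_mul _ hg hf hS
  have hQ : ∀ x : ℝ, σ (Iio x) = ∫⁻ t in Ioo 0 x, q t ^ 2 := fun x => by
    rw [hσ, withDensity_apply _ measurableSet_Iio, hrestr]
  have hR : ∀ x : ℝ, 0 < x → τ (Ioi x) = ∫⁻ t in Ioi x, W t ^ 2 := fun x hx => by
    rw [hτ, withDensity_apply _ measurableSet_Ioi, hrestr' x hx]
  have hRfin : ∀ x : ℝ, 0 < x → τ (Ioi x) ≠ ∞ := fun x hx => by
    rw [hR x hx]
    exact ne_top_of_le_ne_top hWfin (lintegral_mono_set (Ioi_subset_Ioi hx.le))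
  have hQm : Measurable fun t => σ (Iio t) ^ (1 / 2 : ℝ) :=
    (measurable_measure_Iio σ).pow_const _
  have hsqrt : ∀ x : ℝ, 0 < x → σ (Iio x) ^ (1 / 2 : ℝ) * τ (Ioi x) ^ (1 / 2 : ℝ) ≤ A := by
    intro x hx
    rw [← ENNReal.mul_rpow_of_nonneg _ _ (by norm_num), hQ, hR x hx, mul_comm]
    calc _ ≤ (A ^ 2) ^ (1 / 2 : ℝ) := by gcongr; exact hWq x hx
      _ = A := by
        rw [sq, ENNReal.mul_rpow_of_nonneg _ _ (by norm_num), sqrt_mul_self_ennreal]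
  -- Cauchy–Schwarz with the weight `Q ^ (1/4)`, `Q x = ∫_0^x q ^ 2`
  have hCS : ∀ x : ℝ, 0 < x → (∫⁻ t in Ioo 0 x, q t * h t) ^ 2 ≤
      2 * σ (Iio x) ^ (1 / 2 : ℝ) * ∫⁻ t in Ioo 0 x, h t ^ 2 * σ (Iio t) ^ (1 / 2 : ℝ) := by
    intro x hx
    set s : ℝ → ℝ≥0∞ := fun t => (σ (Iio t) ^ (1 / 2 : ℝ)) ^ (1 / 2 : ℝ) with hs
    have hsm : Measurable s := hQm.pow_const _
    have hss : ∀ t, s t ^ 2 = σ (Iio t) ^ (1 / 2 : ℝ) := fun t => by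
      rw [sq, hs, sqrt_mul_self_ennreal]
    have h1 : ∫⁻ t in Ioo 0 x, q t * h t = ∫⁻ t in Ioo 0 x, (q t * (s t)⁻¹) * (h t * s t) := by
      refine setLIntegral_congr_fun measurableSet_Ioo fun t ht => ?_
      have h2 : s t ≠ 0 := by simp [hs, hQ, hq0 t ht.1]
      have h3 : s t ≠ ∞ := by simp [hs, hQ, hqfin t ht.1]
      calc q t * h t = q t * h t * ((s t)⁻¹ * s t) := by
            rw [ENNReal.inv_mul_cancel h2 h3, mul_one]
        _ = (q t * (s t)⁻¹) * (h t * s t) := by ring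
    rw [h1]
    refine (sq_lintegral_mul_le (hq.mul hsm.inv).aemeasurable (hh.mul hsm).aemeasurable).trans ?_
    refine mul_le_mul' ?_ (le_of_eq ?_)
    · calc ∫⁻ t in Ioo 0 x, (q t * (s t)⁻¹) ^ 2
          = ∫⁻ t in Iio x, (σ (Iio t) ^ (1 / 2 : ℝ))⁻¹ ∂σ := by
            have hQm' : Measurable fun t => (σ (Iio t) ^ (1 / 2 : ℝ))⁻¹ := hQm.inv
            rw [hden (hq.pow_const 2) hQm' measurableSet_Iio, hrestr]
            refine lintegral_congr fun t => ?_
            rw [mul_pow, ← ENNReal.inv_pow, hss]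
        _ ≤ _ := lintegral_Iio_inv_sqrt_le σ (by rw [hQ]; exact hqfin x hx)
    · exact lintegral_congr fun t => by rw [Pi.mul_apply, mul_pow, hss]
  have htail : ∀ t : ℝ, 0 < t → ∫⁻ x in Ioi t, W x ^ 2 * (2 * σ (Iio x) ^ (1 / 2 : ℝ)) ≤
      4 * A * τ (Ioi t) ^ (1 / 2 : ℝ) := by
    intro t ht
    have hRm : Measurable fun t => (τ (Ioi t) ^ (1 / 2 : ℝ))⁻¹ :=
      ((measurable_measure_Ioi τ).pow_const _).inv
    calc ∫⁻ x in Ioi t, W x ^ 2 * (2 * σ (Iio x) ^ (1 / 2 : ℝ))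
        ≤ ∫⁻ x in Ioi t, (2 * A) * (W x ^ 2 * (τ (Ioi x) ^ (1 / 2 : ℝ))⁻¹) := by
          refine setLIntegral_mono' measurableSet_Ioi fun x hx => ?_
          have h1 : σ (Iio x) ^ (1 / 2 : ℝ) ≤ A * (τ (Ioi x) ^ (1 / 2 : ℝ))⁻¹ := by
            rw [← div_eq_mul_inv, ENNReal.le_div_iff_mul_le (Or.inr hA0) (Or.inr hA)]
            exact hsqrt x (ht.trans hx)
          calc W x ^ 2 * (2 * σ (Iio x) ^ (1 / 2 : ℝ))
              ≤ W x ^ 2 * (2 * (A * (τ (Ioi x) ^ (1 / 2 : ℝ))⁻¹)) := by gcongr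
            _ = _ := by ring
      _ = (2 * A) * ∫⁻ x in Ioi t, (τ (Ioi x) ^ (1 / 2 : ℝ))⁻¹ ∂τ := by
          rw [hden (hW.pow_const 2) hRm measurableSet_Ioi, hrestr' t ht]
          exact lintegral_const_mul _ ((hW.pow_const 2).mul hRm)
      _ ≤ (2 * A) * (2 * τ (Ioi t) ^ (1 / 2 : ℝ)) := by
          gcongr
          exact lintegral_Ioi_inv_sqrt_le τ (hRfin t ht)
      _ = _ := by ring
  set F : ℝ → ℝ≥0∞ := fun x => W x ^ 2 * (2 * σ (Iio x) ^ (1 / 2 : ℝ)) with hF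
  set G : ℝ → ℝ≥0∞ := fun t => h t ^ 2 * σ (Iio t) ^ (1 / 2 : ℝ) with hG
  have hFm : Measurable F := (hW.pow_const 2).mul (hQm.const_mul 2)
  have hGm : Measurable G := (hh.pow_const 2).mul hQm
  calc ∫⁻ x in Ioi (0 : ℝ), (W x * ∫⁻ t in Ioo 0 x, q t * h t) ^ 2
      ≤ ∫⁻ x in Ioi (0 : ℝ), ∫⁻ t in Ioi (0 : ℝ), (Iio x).indicator (fun t => F x * G t) t := by
        refine setLIntegral_mono' measurableSet_Ioi fun x hx => ?_
        rw [lintegral_indicator measurableSet_Iio, hrestr, lintegral_const_mul _ hGm, mul_pow, hF]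
        calc _ ≤ W x ^ 2 * _ := mul_le_mul_right (hCS x hx) _
          _ = _ := by ring
    _ = ∫⁻ t in Ioi (0 : ℝ), ∫⁻ x in Ioi (0 : ℝ), (Iio x).indicator (fun t => F x * G t) t := by
        refine lintegral_lintegral_swap ?_
        refine Measurable.aemeasurable ?_
        have h1 : (Function.uncurry fun x t => (Iio x).indicator (fun t => F x * G t) t) =
            {p : ℝ × ℝ | p.2 < p.1}.indicator fun p => F p.1 * G p.2 := by
          funext ⟨x, t⟩
          simp [Set.indicator]
        rw [h1]
        exact ((hFm.comp measurable_fst).mul (hGm.comp measurable_snd)).indicator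
          (measurableSet_lt measurable_snd measurable_fst)
    _ ≤ ∫⁻ t in Ioi (0 : ℝ), 4 * A ^ 2 * h t ^ 2 := by
        refine setLIntegral_mono' measurableSet_Ioi fun t ht => ?_
        have h1 : ∫⁻ x in Ioi (0 : ℝ), (Iio x).indicator (fun t => F x * G t) t =
            G t * ∫⁻ x in Ioi t, F x := by
          have h2 : ∀ x, (Iio x).indicator (fun t => F x * G t) t =
              (Ioi t).indicator (fun x => G t * F x) x := fun x => by
            simp [Set.indicator, mul_comm]
          rw [lintegral_congr h2, lintegral_indicator measurableSet_Ioi, hrestr' t ht,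
            lintegral_const_mul _ hFm]
        rw [h1]
        calc G t * ∫⁻ x in Ioi t, F x ≤ G t * (4 * A * τ (Ioi t) ^ (1 / 2 : ℝ)) := by
              gcongr
              exact htail t ht
          _ = 4 * A * h t ^ 2 * (σ (Iio t) ^ (1 / 2 : ℝ) * τ (Ioi t) ^ (1 / 2 : ℝ)) := by
              rw [hG]; ring
          _ ≤ 4 * A * h t ^ 2 * A := by
              gcongr
              exact hsqrt t ht
          _ = _ := by ring
    _ = 4 * A ^ 2 * ∫⁻ t in Ioi (0 : ℝ), h t ^ 2 := lintegral_const_mul _ (hh.pow_const 2)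

/-- The sufficiency half of Muckenhoupt's weighted Hardy inequality in `L²`: the operator
`h ↦ W(x) ∫_0^x q h` is bounded with constant `2 A` as soon as
`‖W‖_{L²(x,∞)} ‖q‖_{L²(0,x)} ≤ A` for all `x > 0`. -/
theorem lintegral_hardy {W q h : ℝ → ℝ≥0∞} (hW : AEMeasurable W vol₊)
    (hq : AEMeasurable q vol₊) (hh : AEMeasurable h vol₊) {A : ℝ≥0∞} (hA0 : A ≠ 0) (hA : A ≠ ∞)
    (hq0 : ∀ x : ℝ, 0 < x → ∫⁻ t in Ioo 0 x, q t ^ 2 ≠ 0)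
    (hqfin : ∀ x : ℝ, 0 < x → ∫⁻ t in Ioo 0 x, q t ^ 2 ≠ ∞)
    (hWfin : ∫⁻ t in Ioi 0, W t ^ 2 ≠ ∞)
    (hWq : ∀ x : ℝ, 0 < x → (∫⁻ t in Ioi x, W t ^ 2) * ∫⁻ t in Ioo 0 x, q t ^ 2 ≤ A ^ 2) :
    ∫⁻ x in Ioi (0 : ℝ), (W x * ∫⁻ t in Ioo 0 x, q t * h t) ^ 2 ≤
      4 * A ^ 2 * ∫⁻ t in Ioi (0 : ℝ), h t ^ 2 := by
  have hsub : ∀ x : ℝ, ∀ {p : ℝ → Prop}, (∀ᵐ t ∂vol₊, p t) →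
      ∀ᵐ t ∂volume.restrict (Ioo 0 x), p t := fun x _ hp =>
    ae_restrict_of_ae_restrict_of_subset Ioo_subset_Ioi_self hp
  have hsub' : ∀ x : ℝ, 0 < x → ∀ {p : ℝ → Prop}, (∀ᵐ t ∂vol₊, p t) →
      ∀ᵐ t ∂volume.restrict (Ioi x), p t := fun x hx _ hp =>
    ae_restrict_of_ae_restrict_of_subset (Ioi_subset_Ioi hx.le) hp
  have eq : ∀ x : ℝ, ∫⁻ t in Ioo 0 x, q t ^ 2 = ∫⁻ t in Ioo 0 x, hq.mk q t ^ 2 := fun x =>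
    lintegral_congr_ae ((hsub x hq.ae_eq_mk).mono fun t ht => by simp only [ht])
  have eW : ∀ x : ℝ, 0 < x → ∫⁻ t in Ioi x, W t ^ 2 = ∫⁻ t in Ioi x, hW.mk W t ^ 2 := fun x hx =>
    lintegral_congr_ae ((hsub' x hx hW.ae_eq_mk).mono fun t ht => by simp only [ht])
  have eW0 : ∫⁻ t in Ioi 0, W t ^ 2 = ∫⁻ t in Ioi 0, hW.mk W t ^ 2 :=
    lintegral_congr_ae (hW.ae_eq_mk.mono fun t ht => by simp only [ht])
  have eh : ∫⁻ t in Ioi 0, h t ^ 2 = ∫⁻ t in Ioi 0, hh.mk h t ^ 2 :=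
    lintegral_congr_ae (hh.ae_eq_mk.mono fun t ht => by simp only [ht])
  have eqh : ∀ x : ℝ, ∫⁻ t in Ioo 0 x, q t * h t = ∫⁻ t in Ioo 0 x, hq.mk q t * hh.mk h t :=
    fun x => lintegral_congr_ae (by
      filter_upwards [hsub x hq.ae_eq_mk, hsub x hh.ae_eq_mk] with t h1 h2
      rw [h1, h2])
  have key := lintegral_hardy_of_measurable hW.measurable_mk hq.measurable_mk hh.measurable_mk
    hA0 hA (fun x hx => eq x ▸ hq0 x hx) (fun x hx => eq x ▸ hqfin x hx) (eW0 ▸ hWfin)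
    (fun x hx => by rw [← eq x, ← eW x hx]; exact hWq x hx)
  rw [eh]
  refine le_trans (le_of_eq (lintegral_congr_ae ?_)) key
  filter_upwards [hW.ae_eq_mk] with x hx
  rw [hx, eqh]

/-! ### Polynomials in weighted `L²` of a doubling weight -/

theorem DoublingClass.integrableOn {δ : ℝ} {w : ℝ → ℝ} (hw : DoublingClass δ w) {r : ℝ}
    (hr : 0 < r) : IntegrableOn w (Ioo 0 r) := by
  obtain ⟨hpos, hloc, C, hC⟩ := hw
  set b := max δ r
  have hb : 0 < b := lt_max_of_lt_right hr
  suffices h : IntegrableOn w (Ioo 0 b) from h.mono_set (Ioo_subset_Ioo_right (le_max_right _ _))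
  have hae : AEStronglyMeasurable w (volume.restrict (Ioo 0 b)) :=
    hloc.aestronglyMeasurable.mono_set Ioo_subset_Ioi_self
  have hmid : IntegrableOn w
      (Ioo ((0 + b) / 2 - (b - 0) / 4) ((0 + b) / 2 + (b - 0) / 4)) := by
    refine (hloc.integrableOn_compact_subset (t := Icc (b / 4) (3 * b / 4)) ?_
      isCompact_Icc).mono_set ?_
    · exact fun x hx => lt_of_lt_of_le (by positivity) hx.1
    · exact fun x hx => ⟨by linarith [hx.1], by linarith [hx.2]⟩
  have hpos' : 0 ≤ᵐ[volume.restrict (Ioo 0 b)] w :=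
    (ae_restrict_of_ae_restrict_of_subset Ioo_subset_Ioi_self hpos).mono fun x hx => le_of_lt hx
  refine ⟨hae, ?_⟩
  rw [hasFiniteIntegral_iff_ofReal hpos']
  refine (hC 0 b le_rfl hb (by simp [b])).trans_lt ?_
  refine ENNReal.mul_lt_top ENNReal.coe_lt_top ?_
  refine lt_of_le_of_lt (lintegral_mono fun x => ?_) hmid.2
  rw [← ofReal_norm]
  exact ENNReal.ofReal_le_ofReal (le_abs_self _)

theorem DoublingClass.setIntegral_pos {δ : ℝ} {w : ℝ → ℝ} (hw : DoublingClass δ w) {r : ℝ}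
    (hr : 0 < r) : 0 < ∫ t in Ioo 0 r, w t := by
  have hpos' : ∀ᵐ x ∂volume.restrict (Ioo 0 r), 0 < w x :=
    ae_restrict_of_ae_restrict_of_subset Ioo_subset_Ioi_self hw.1
  rw [integral_pos_iff_support_of_nonneg_ae (hpos'.mono fun x hx => le_of_lt hx)
    (hw.integrableOn hr)]
  have h1 : (univ : Set ℝ) ≤ᵐ[volume.restrict (Ioo 0 r)] Function.support w :=
    hpos'.mono fun x hx _ => ne_of_gt hx
  refine lt_of_lt_of_le ?_ (measure_mono_ae h1)
  simpa using hr

theorem DoublingClass.exists_setIntegral_le {δ : ℝ} {w : ℝ → ℝ} (hw : DoublingClass δ w) :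
    ∃ C : ℝ, 1 ≤ C ∧ ∀ b : ℝ, 0 < b → δ ≤ b →
      ∫ t in Ioo 0 b, w t ≤ C * ∫ t in Ioo (b / 4) (3 * b / 4), w t := by
  obtain ⟨C, hC⟩ := hw.2.2
  refine ⟨max C 1, le_max_right _ _, fun b hb hδ => ?_⟩
  have hpos : ∀ {s : Set ℝ}, s ⊆ Ioi 0 → 0 ≤ᵐ[volume.restrict s] w := fun hs =>
    (ae_restrict_of_ae_restrict_of_subset hs hw.1).mono fun x hx => le_of_lt hx
  have hsub : Ioo (b / 4) (3 * b / 4) ⊆ Ioo 0 b := fun x hx =>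
    ⟨lt_trans (by positivity) hx.1, hx.2.trans (by linarith)⟩
  have hint := hw.integrableOn hb
  have h1 := hC 0 b le_rfl hb (by simpa using hδ)
  have e1 : (0 + b) / 2 - (b - 0) / 4 = b / 4 := by ring
  have e2 : (0 + b) / 2 + (b - 0) / 4 = 3 * b / 4 := by ring
  rw [e1, e2, ← ofReal_integral_eq_lintegral_ofReal hint (hpos Ioo_subset_Ioi_self),
    ← ofReal_integral_eq_lintegral_ofReal (hint.mono_set hsub)
      (hpos (hsub.trans Ioo_subset_Ioi_self)), ← ENNReal.ofReal_coe_nnreal,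
    ← ENNReal.ofReal_mul C.coe_nonneg] at h1
  have hI : 0 ≤ ∫ t in Ioo (b / 4) (3 * b / 4), w t :=
    integral_nonneg_of_ae (hpos (hsub.trans Ioo_subset_Ioi_self))
  have h2 := (ENNReal.ofReal_le_ofReal_iff (by positivity)).1 h1
  exact h2.trans (mul_le_mul_of_nonneg_right (le_max_left _ _) hI)

/-- The coefficients of a polynomial of degree less than `n` are controlled by its values at `n` nodes
lying in prescribed separated compact intervals, uniformly in the nodes: the inverse of the
Vandermonde matrix is bounded on the compact set of admissible nodes. -/
theorem exists_abs_coeff_le {n : ℕ} (α β : Fin n → ℝ) (h : ∀ i j, i < j → β j < α i) :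
    ∃ K : ℝ, 0 ≤ K ∧ ∀ τ : Fin n → ℝ, (∀ j, τ j ∈ Icc (α j) (β j)) → ∀ (B : Fin n → ℝ) (k : Fin n),
      |B k| ≤ K * ∑ j, |∑ i, B i * τ j ^ (i : ℕ)| := by
  set S : Set (Fin n → ℝ) := univ.pi fun j => Icc (α j) (β j) with hS
  have hSc : IsCompact S := isCompact_univ_pi fun j => isCompact_Icc
  have hdet : ∀ τ ∈ S, (Matrix.vandermonde τ).det ≠ 0 := by
    intro τ hτ
    rw [Matrix.det_vandermonde_ne_zero_iff]
    have hanti : StrictAnti τ := fun i j hij =>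
      ((hτ j trivial).2.trans_lt (h i j hij)).trans_le (hτ i trivial).1
    exact hanti.injective
  have hV : Continuous fun τ : Fin n → ℝ => Matrix.vandermonde τ := by
    refine continuous_matrix fun i j => ?_
    simp only [Matrix.vandermonde_apply]
    fun_prop
  have hcont : ∀ k j, ContinuousOn (fun τ => (Matrix.vandermonde τ)⁻¹ k j) S := by
    intro k j
    have h1 : ∀ τ : Fin n → ℝ, (Matrix.vandermonde τ)⁻¹ k j =
        (Matrix.vandermonde τ).det⁻¹ * (Matrix.vandermonde τ).adjugate k j := fun τ => by
      rw [Matrix.inv_def, Ring.inverse_eq_inv', Matrix.smul_apply, smul_eq_mul]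
    simp only [h1]
    exact (hV.matrix_det.continuousOn.inv₀ hdet).mul
      (hV.matrix_adjugate.matrix_elem k j).continuousOn
  choose K hK using fun k j => hSc.exists_bound_of_continuousOn (hcont k j)
  refine ⟨∑ k, ∑ j, |K k j|, by positivity, fun τ hτ B k => ?_⟩
  have hτS : τ ∈ S := fun j _ => hτ j
  set y : Fin n → ℝ := (Matrix.vandermonde τ).mulVec B with hy
  have hyj : ∀ j, y j = ∑ i, B i * τ j ^ (i : ℕ) := fun j => by
    simp [hy, Matrix.mulVec, dotProduct, Matrix.vandermonde_apply, mul_comm]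
  have hB : B = (Matrix.vandermonde τ)⁻¹.mulVec y := by
    rw [hy, Matrix.mulVec_mulVec, Matrix.nonsing_inv_mul _ (isUnit_iff_ne_zero.2 (hdet τ hτS)),
      Matrix.one_mulVec]
  simp only [← hyj]
  calc |B k| = |∑ j, (Matrix.vandermonde τ)⁻¹ k j * y j| := by
        conv_lhs => rw [hB]
        rfl
    _ ≤ ∑ j, |(Matrix.vandermonde τ)⁻¹ k j * y j| := Finset.abs_sum_le_sum_abs _ _
    _ ≤ ∑ j, (∑ k, ∑ j, |K k j|) * |y j| := by
        refine Finset.sum_le_sum fun j _ => ?_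
        rw [abs_mul]
        refine mul_le_mul_of_nonneg_right ?_ (abs_nonneg _)
        calc |(Matrix.vandermonde τ)⁻¹ k j| ≤ K k j := hK k j τ hτS
          _ ≤ |K k j| := le_abs_self _
          _ ≤ ∑ j, |K k j| :=
            Finset.single_le_sum (f := fun j => |K k j|) (fun _ _ => abs_nonneg _)
              (Finset.mem_univ j)
          _ ≤ _ :=
            Finset.single_le_sum (f := fun k => ∑ j, |K k j|)
              (fun _ _ => Finset.sum_nonneg fun _ _ => abs_nonneg _) (Finset.mem_univ k)
    _ = _ := by rw [Finset.mul_sum]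

/-- A mean value statement: the node is a minimum point of `p ^ 2`. -/
theorem exists_sq_mul_setIntegral_le {w p : ℝ → ℝ} (hp : Continuous p) {a b : ℝ} (hab : a ≤ b)
    (ha : 0 ≤ a) (hw : ∀ᵐ x ∂vol₊, 0 < w x) (hint : IntegrableOn w (Ioo a b))
    (hpint : IntegrableOn (fun t => p t ^ 2 * w t) (Ioo a b)) :
    ∃ t ∈ Icc a b, p t ^ 2 * ∫ x in Ioo a b, w x ≤ ∫ x in Ioo a b, p x ^ 2 * w x := by
  obtain ⟨t, ht, hmin⟩ := isCompact_Icc.exists_isMinOn (nonempty_Icc.2 hab)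
    (hp.pow 2).continuousOn
  refine ⟨t, ht, ?_⟩
  rw [← integral_const_mul]
  refine integral_mono_ae (hint.const_mul _) hpint ?_
  have hw' := ae_restrict_of_ae_restrict_of_subset
    (fun x hx => lt_of_le_of_lt ha hx.1 : Ioo a b ⊆ Ioi 0) hw
  filter_upwards [hw', ae_restrict_mem measurableSet_Ioo] with x hx hxm
  exact mul_le_mul_of_nonneg_right (hmin (Ioo_subset_Icc_self hxm)) hx.le

theorem integrableOn_continuous_mul {w p : ℝ → ℝ} (hp : Continuous p) {r : ℝ}
    (hint : IntegrableOn w (Ioo 0 r)) : IntegrableOn (fun t => p t * w t) (Ioo 0 r) := by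
  rw [← integrableOn_Icc_iff_integrableOn_Ioo] at hint ⊢
  exact hint.continuousOn_mul hp.continuousOn isCompact_Icc

/-- On long intervals `(0, r)` the monomials `t ^ k`, normalized in `L²(w)`, are uniformly linearly
independent. The doubling condition makes the weight of each of `n` separated intervals inside
`(0, r)` comparable with that of `(0, r)`, so that the polynomial takes values of the size of its
mean in each of them. -/
theorem DoublingClass.exists_coeff_bound {δ : ℝ} {w : ℝ → ℝ} (hw : DoublingClass δ w) (n : ℕ) :
    ∃ K r₀ : ℝ, 0 ≤ K ∧ 0 < r₀ ∧ ∀ r, r₀ ≤ r → ∀ (a : Fin n → ℝ) (k : Fin n),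
      (a k * r ^ (k : ℕ)) ^ 2 * ∫ t in Ioo 0 r, w t ≤
        K * ∫ t in Ioo 0 r, (∑ i, a i * t ^ (i : ℕ)) ^ 2 * w t := by
  obtain ⟨C, hC1, hC⟩ := hw.exists_setIntegral_le
  have hC0 : 0 ≤ C := by linarith
  -- doubling shrinks `(0, b)` to `(0, 3 b / 4)`; five such steps separate the nodes
  obtain ⟨ρ, hρ⟩ : ∃ ρ : ℝ, ρ = (3 / 4) ^ 5 := ⟨_, rfl⟩
  have hρ0 : 0 < ρ := by rw [hρ]; positivity
  have hρ1 : ρ < 1 / 3 := by norm_num [hρ]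
  have hnode : ∀ i j : Fin n, i < j → 3 / 4 * ρ ^ (j : ℕ) < ρ ^ (i : ℕ) / 4 := by
    intro i j hij
    have h1 : ρ ^ (j : ℕ) ≤ ρ ^ ((i : ℕ) + 1) :=
      pow_le_pow_of_le_one hρ0.le (by linarith) (Fin.lt_def.1 hij)
    have h2 : 0 < ρ ^ (i : ℕ) := by positivity
    rw [pow_succ] at h1
    nlinarith
  obtain ⟨K, hK0, hK⟩ := exists_abs_coeff_le (fun j : Fin n => ρ ^ (j : ℕ) / 4)
    (fun j => 3 / 4 * ρ ^ (j : ℕ)) hnode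
  have hpos : ∀ {s : Set ℝ}, s ⊆ Ioi 0 → 0 ≤ᵐ[volume.restrict s] w := fun hs =>
    (ae_restrict_of_ae_restrict_of_subset hs hw.1).mono fun x hx => le_of_lt hx
  refine ⟨K ^ 2 * (n * (n * C ^ (5 * n + 1))), max δ 1 / ρ ^ n, by positivity, by positivity,
    fun r hr a k => ?_⟩
  have hr' : max δ 1 ≤ ρ ^ n * r := by
    rw [div_le_iff₀ (by positivity)] at hr
    linarith
  have hr0 : 0 < r := by
    have : 0 < ρ ^ n * r := lt_of_lt_of_le (by positivity) hr'
    exact pos_of_mul_pos_right this (by positivity)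
  have hwr := hw.integrableOn hr0
  set p : ℝ → ℝ := fun t => ∑ i, a i * t ^ (i : ℕ) with hp
  have hpc : Continuous p := by fun_prop
  set I : ℝ := ∫ t in Ioo 0 r, p t ^ 2 * w t with hI
  -- the mass of `(0, r)` is controlled by that of the shorter intervals with left end `0`
  have hshrink : ∀ i : ℕ, i ≤ 5 * n →
      ∫ t in Ioo 0 r, w t ≤ C ^ i * ∫ t in Ioo 0 ((3 / 4) ^ i * r), w t := by
    intro i
    induction i with
    | zero => intro _; simp
    | succ i ih =>
      intro hi
      have hb0 : 0 < (3 / 4 : ℝ) ^ i * r := by positivity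
      have hbδ : δ ≤ (3 / 4 : ℝ) ^ i * r := by
        refine (le_max_left δ 1).trans (hr'.trans (mul_le_mul_of_nonneg_right ?_ hr0.le))
        rw [hρ, ← pow_mul]
        exact pow_le_pow_of_le_one (by norm_num) (by norm_num) (by omega)
      have h1 := hC _ hb0 hbδ
      have h2 : ∫ t in Ioo ((3 / 4 : ℝ) ^ i * r / 4) (3 * ((3 / 4 : ℝ) ^ i * r) / 4), w t ≤
          ∫ t in Ioo 0 ((3 / 4 : ℝ) ^ (i + 1) * r), w t := by
        refine setIntegral_mono_set (hw.integrableOn (by positivity))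
          (hpos Ioo_subset_Ioi_self) (Filter.Eventually.of_forall ?_)
        intro x hx
        refine ⟨lt_trans (by positivity) hx.1, hx.2.trans_le (le_of_eq ?_)⟩
        rw [pow_succ]
        ring
      calc ∫ t in Ioo 0 r, w t ≤ C ^ i * ∫ t in Ioo 0 ((3 / 4) ^ i * r), w t := ih (by omega)
        _ ≤ C ^ i * (C * ∫ t in Ioo 0 ((3 / 4 : ℝ) ^ (i + 1) * r), w t) := by
          gcongr
          exact h1.trans (by gcongr)
        _ = _ := by ring
  -- `Icc (b / 4) (3 * b / 4)` is the concentric half of `[0, b]`, and for `b = ρ ^ j * r` these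
  -- halves are separated because `ρ < 1 / 3`
  have hnodes : ∀ j : Fin n, ∃ t ∈ Icc (ρ ^ (j : ℕ) * r / 4) (3 * (ρ ^ (j : ℕ) * r) / 4),
      p t ^ 2 * ∫ x in Ioo 0 r, w x ≤ C ^ (5 * n + 1) * I := by
    intro j
    set b : ℝ := ρ ^ (j : ℕ) * r with hb
    have hb0 : 0 < b := by positivity
    have hbr : b ≤ r := mul_le_of_le_one_left hr0.le (pow_le_one₀ hρ0.le (by linarith))
    have hbδ : δ ≤ b := by
      refine (le_max_left δ 1).trans (hr'.trans (mul_le_mul_of_nonneg_right ?_ hr0.le))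
      exact pow_le_pow_of_le_one hρ0.le (by linarith) j.2.le
    have hsub : Ioo (b / 4) (3 * b / 4) ⊆ Ioo 0 r := fun x hx =>
      ⟨lt_trans (by positivity) hx.1, hx.2.trans (by linarith)⟩
    have hpw := integrableOn_continuous_mul (hpc.pow 2) hwr
    obtain ⟨t, ht, hle⟩ := exists_sq_mul_setIntegral_le hpc
      (show b / 4 ≤ 3 * b / 4 by linarith) (by positivity) hw.1 (hwr.mono_set hsub)
      (hpw.mono_set hsub)
    refine ⟨t, ht, ?_⟩
    have h1 : ∫ x in Ioo 0 r, w x ≤ C ^ (5 * n + 1) * ∫ x in Ioo (b / 4) (3 * b / 4), w x := by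
      have h2 := hshrink (5 * j) (by omega)
      rw [pow_mul (3 / 4 : ℝ), ← hρ, ← hb] at h2
      have hnn : 0 ≤ ∫ x in Ioo (b / 4) (3 * b / 4), w x :=
        integral_nonneg_of_ae (hpos (hsub.trans Ioo_subset_Ioi_self))
      calc ∫ x in Ioo 0 r, w x ≤ C ^ (5 * (j : ℕ)) * ∫ x in Ioo 0 b, w x := h2
        _ ≤ C ^ (5 * (j : ℕ)) * (C * ∫ x in Ioo (b / 4) (3 * b / 4), w x) := by
          gcongr
          exact hC b hb0 hbδ
        _ = C ^ (5 * (j : ℕ) + 1) * ∫ x in Ioo (b / 4) (3 * b / 4), w x := by ring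
        _ ≤ _ := by
          gcongr
          exact j.2.le
    have h3 : ∫ x in Ioo (b / 4) (3 * b / 4), p x ^ 2 * w x ≤ I := by
      refine setIntegral_mono_set hpw ?_ (Filter.Eventually.of_forall hsub)
      filter_upwards [hpos (Ioo_subset_Ioi_self : Ioo 0 r ⊆ Ioi 0)] with x hx
      exact mul_nonneg (sq_nonneg _) hx
    calc p t ^ 2 * ∫ x in Ioo 0 r, w x
        ≤ p t ^ 2 * (C ^ (5 * n + 1) * ∫ x in Ioo (b / 4) (3 * b / 4), w x) := by gcongr
      _ = C ^ (5 * n + 1) * (p t ^ 2 * ∫ x in Ioo (b / 4) (3 * b / 4), w x) := by ring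
      _ ≤ C ^ (5 * n + 1) * I := by
        gcongr
        exact hle.trans h3
  choose t ht hle using hnodes
  set S : ℝ := ∫ x in Ioo 0 r, w x with hS
  have hS0 : 0 ≤ S := (hw.setIntegral_pos hr0).le
  have hval : ∀ j, ∑ i : Fin n, (a i * r ^ (i : ℕ)) * (t j / r) ^ (i : ℕ) = p (t j) := by
    intro j
    refine Finset.sum_congr rfl fun i _ => ?_
    rw [div_pow]
    field_simp
  have h1 := hK (fun j => t j / r) (fun j => by
    constructor
    · rw [le_div_iff₀ hr0]; linarith [(ht j).1]
    · rw [div_le_iff₀ hr0]; linarith [(ht j).2]) (fun i => a i * r ^ (i : ℕ)) k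
  simp only [hval] at h1
  calc (a k * r ^ (k : ℕ)) ^ 2 * S ≤ (K * ∑ j, |p (t j)|) ^ 2 * S := by
        rw [← sq_abs (a k * r ^ (k : ℕ))]
        gcongr
    _ = K ^ 2 * ((∑ j, |p (t j)|) ^ 2 * S) := by ring
    _ ≤ K ^ 2 * ((n * ∑ j, |p (t j)| ^ 2) * S) := by
        gcongr
        simpa using sq_sum_le_card_mul_sum_sq (s := Finset.univ) (f := fun j => |p (t j)|)
    _ = K ^ 2 * (n * ∑ j, p (t j) ^ 2 * S) := by
        simp only [sq_abs, Finset.sum_mul, mul_assoc]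
    _ ≤ K ^ 2 * (n * ∑ _j : Fin n, C ^ (5 * n + 1) * I) := by
        refine mul_le_mul_of_nonneg_left (mul_le_mul_of_nonneg_left ?_ n.cast_nonneg)
          (sq_nonneg K)
        exact Finset.sum_le_sum fun j _ => hle j
    _ = K ^ 2 * (n * (n * C ^ (5 * n + 1))) * I := by
        simp only [Finset.sum_const, Finset.card_univ, Fintype.card_fin, nsmul_eq_mul]
        ring

/-- The dual basis of the monomials: a polynomial `p` whose moments on `(0, r)` against `t ^ i w`
vanish except for `i = k`, with the norm in `L²(w)` that duality allows up to a constant independent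
of `r`. It is found by inverting the Gram matrix of the monomials. -/
theorem DoublingClass.exists_dual_polynomial {δ : ℝ} {w : ℝ → ℝ} (hw : DoublingClass δ w)
    (n : ℕ) :
    ∃ K r₀ : ℝ, 0 ≤ K ∧ 0 < r₀ ∧ ∀ r, r₀ ≤ r → ∀ k : Fin n, ∃ p : ℝ → ℝ, Continuous p ∧
      (∀ i : Fin n, ∫ t in Ioo 0 r, p t * t ^ (i : ℕ) * w t = if i = k then 1 else 0) ∧
      (∫ t in Ioo 0 r, p t ^ 2 * w t) * ((r ^ (k : ℕ)) ^ 2 * ∫ t in Ioo 0 r, w t) ≤ K := by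
  obtain ⟨K, r₀, hK0, hr₀, hK⟩ := hw.exists_coeff_bound n
  refine ⟨K, r₀, hK0, hr₀, fun r hr k => ?_⟩
  have hr0 : 0 < r := hr₀.trans_le hr
  have hwr := hw.integrableOn hr0
  have hS := hw.setIntegral_pos hr0
  set G : Matrix (Fin n) (Fin n) ℝ := fun i j => ∫ t in Ioo 0 r, t ^ (j : ℕ) * t ^ (i : ℕ) * w t
    with hG
  have hmom : ∀ (a : Fin n → ℝ) (i : Fin n),
      ∫ t in Ioo 0 r, (∑ j, a j * t ^ (j : ℕ)) * t ^ (i : ℕ) * w t = G.mulVec a i := by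
    intro a i
    have h1 : ∀ t : ℝ, (∑ j, a j * t ^ (j : ℕ)) * t ^ (i : ℕ) * w t =
        ∑ j, a j * (t ^ (j : ℕ) * t ^ (i : ℕ) * w t) := fun t => by
      simp only [Finset.sum_mul]
      exact Finset.sum_congr rfl fun j _ => by ring
    simp only [h1]
    rw [integral_finsetSum _ fun j _ => ?_]
    · simp only [integral_const_mul, Matrix.mulVec, dotProduct, hG]
      exact Finset.sum_congr rfl fun j _ => by ring
    · exact (integrableOn_continuous_mul (by fun_prop) hwr).const_mul _
  have hsq : ∀ a : Fin n → ℝ, ∫ t in Ioo 0 r, (∑ j, a j * t ^ (j : ℕ)) ^ 2 * w t =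
      ∑ i, a i * G.mulVec a i := by
    intro a
    have h1 : ∀ t : ℝ, (∑ j, a j * t ^ (j : ℕ)) ^ 2 * w t =
        ∑ i, a i * ((∑ j, a j * t ^ (j : ℕ)) * t ^ (i : ℕ) * w t) := fun t => by
      rw [sq, mul_assoc, Finset.sum_mul]
      exact Finset.sum_congr rfl fun i _ => by ring
    simp only [h1]
    rw [integral_finsetSum _ fun i _ => ?_]
    · simp only [integral_const_mul, hmom]
    · exact (integrableOn_continuous_mul (by fun_prop) hwr).const_mul _
  -- a polynomial in the kernel of the Gram matrix has zero norm
  have hinj : Function.Injective G.mulVecLin := by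
    rw [← LinearMap.ker_eq_bot, LinearMap.ker_eq_bot']
    intro a ha
    have ha' : G.mulVec a = 0 := ha
    funext i
    have h1 := hK r hr a i
    rw [hsq, ha'] at h1
    simp only [Pi.zero_apply, mul_zero, Finset.sum_const_zero] at h1
    have h2 : (a i * r ^ (i : ℕ)) ^ 2 = 0 := by
      refine le_antisymm ?_ (sq_nonneg _)
      exact nonpos_of_mul_nonpos_left h1 hS
    have h3 := pow_eq_zero_iff (two_ne_zero) |>.1 h2
    rcases mul_eq_zero.1 h3 with h4 | h4
    · exact h4
    · exact absurd h4 (by positivity)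
  obtain ⟨a, ha⟩ := LinearMap.injective_iff_surjective.1 hinj (Pi.single k 1)
  have ha' : G.mulVec a = Pi.single k 1 := ha
  have hak : ∫ t in Ioo 0 r, (∑ j, a j * t ^ (j : ℕ)) ^ 2 * w t = a k := by
    rw [hsq, ha']
    simp [Pi.single_apply]
  refine ⟨fun t => ∑ j, a j * t ^ (j : ℕ), by fun_prop, fun i => ?_, ?_⟩
  · rw [hmom, ha', Pi.single_apply]
  · have h1 := hK r hr a k
    rw [hak] at h1 ⊢
    rcases le_or_gt (a k) 0 with h2 | h2
    · exact (mul_nonpos_of_nonpos_of_nonneg h2 (by positivity)).trans hK0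
    · have h3 : a k * (a k * ((r ^ (k : ℕ)) ^ 2 * ∫ t in Ioo 0 r, w t)) ≤ a k * K := by
        linarith [h1, show (a k * r ^ (k : ℕ)) ^ 2 * ∫ t in Ioo 0 r, w t =
          a k * (a k * ((r ^ (k : ℕ)) ^ 2 * ∫ t in Ioo 0 r, w t)) by ring]
      exact le_of_mul_le_mul_left h3 h2

/-! ### Operators on `L²` of the half-line -/

theorem eLpNorm_two_sq (f : ℝ → ℝ) (μ : Measure ℝ) :
    eLpNorm f 2 μ ^ 2 = ∫⁻ x, ‖f x‖ₑ ^ 2 ∂μ := by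
  have h := eLpNorm_nnreal_pow_eq_lintegral (f := f) (μ := μ) (p := 2) two_ne_zero
  simpa using h

theorem eLpNorm_two_eq_sqrt {f : ℝ → ℝ} {μ : Measure ℝ} (hf : MemLp f 2 μ) :
    eLpNorm f 2 μ = ENNReal.ofReal (√(∫ x, f x ^ 2 ∂μ)) := by
  rw [hf.eLpNorm_eq_integral_rpow_norm two_ne_zero ENNReal.ofNat_ne_top, Real.sqrt_eq_rpow]
  simp

theorem aestronglyMeasurable_halfLine {f : ℝ → ℝ}
    (hf : ∀ r : ℝ, 0 < r → AEStronglyMeasurable f (volume.restrict (Ioo 0 r))) :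
    AEStronglyMeasurable f vol₊ := by
  have h1 : Ioi (0 : ℝ) = ⋃ n : ℕ, Ioo 0 ((n : ℝ) + 1) := by
    ext x
    simp only [mem_Ioi, mem_iUnion, mem_Ioo]
    refine ⟨fun hx => ?_, fun ⟨_, hx⟩ => hx.1⟩
    obtain ⟨n, hn⟩ := exists_nat_gt x
    exact ⟨n, hx, by linarith⟩
  rw [h1]
  exact AEStronglyMeasurable.iUnion fun n => hf _ (by positivity)

theorem DoublingClass.memLp_inv {δ : ℝ} {u : ℝ → ℝ} (hu : ∀ᵐ x ∂vol₊, 0 < u x)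
    (huB : DoublingClass δ fun x => (u x ^ 2)⁻¹) {r : ℝ} (hr : 0 < r) :
    MemLp (fun x => (u x)⁻¹) 2 (volume.restrict (Ioo 0 r)) := by
  have h1 := huB.integrableOn hr
  have h2 : AEStronglyMeasurable (fun x => (u x)⁻¹) (volume.restrict (Ioo 0 r)) := by
    refine (Real.continuous_sqrt.comp_aestronglyMeasurable h1.1).congr ?_
    filter_upwards [ae_restrict_of_ae_restrict_of_subset Ioo_subset_Ioi_self hu] with x hx
    rw [← inv_pow, Real.sqrt_sq (inv_nonneg.2 hx.le)]
  rw [memLp_two_iff_integrable_sq h2]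
  simpa only [inv_pow, IntegrableOn] using h1

theorem memLp_mul_of_continuous {p U : ℝ → ℝ} (hp : Continuous p) {r : ℝ}
    (hU : MemLp U 2 (volume.restrict (Ioo 0 r))) :
    MemLp (fun t => p t * U t) 2 (volume.restrict (Ioo 0 r)) := by
  have hm : AEStronglyMeasurable (fun t => p t * U t) (volume.restrict (Ioo 0 r)) :=
    hp.aestronglyMeasurable.mul hU.1
  rw [memLp_two_iff_integrable_sq hm]
  have h1 := (memLp_two_iff_integrable_sq hU.1).1 hU
  simpa only [mul_pow, IntegrableOn] using! integrableOn_continuous_mul (hp.pow 2) h1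

theorem memLp_of_continuousOn_Icc {f : ℝ → ℝ} (hf : ContinuousOn f (Icc 0 1)) :
    MemLp f 2 (volume.restrict (Ioo (0 : ℝ) 1)) := by
  obtain ⟨C, hC⟩ := isCompact_Icc.exists_bound_of_continuousOn hf
  refine MemLp.of_bound ((hf.mono Ioo_subset_Icc_self).aestronglyMeasurable measurableSet_Ioo) C ?_
  filter_upwards [ae_restrict_mem measurableSet_Ioo] with x hx
  exact hC x (Ioo_subset_Icc_self hx)

/-- The closed graph theorem for a linear operator on `L²` given by a pointwise formula: it is bounded
if it maps `L²` to itself and respects a.e. convergence along sequences that also converge in `L²`. -/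
theorem exists_eLpNorm_le_of_ae_tendsto {μ : Measure ℝ} (S : Lp ℝ 2 μ → ℝ → ℝ)
    (hS : ∀ h, MemLp (S h) 2 μ) (hadd : ∀ h h', S (h + h') =ᵐ[μ] fun x => S h x + S h' x)
    (hsmul : ∀ (c : ℝ) h, S (c • h) =ᵐ[μ] fun x => c * S h x)
    (hlim : ∀ (H : ℕ → Lp ℝ 2 μ) (h : Lp ℝ 2 μ), Filter.Tendsto H Filter.atTop (nhds h) →
      (∀ᵐ x ∂μ, Filter.Tendsto (fun n => H n x) Filter.atTop (nhds (h x))) →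
      ∀ᵐ x ∂μ, Filter.Tendsto (fun n => S (H n) x) Filter.atTop (nhds (S h x))) :
    ∃ C : ℝ, 0 ≤ C ∧ ∀ h, eLpNorm (S h) 2 μ ≤ ENNReal.ofReal (C * ‖h‖) := by
  let T : Lp ℝ 2 μ →ₗ[ℝ] Lp ℝ 2 μ :=
    { toFun := fun h => (hS h).toLp
      map_add' := fun h h' => by
        rw [← MemLp.toLp_add]
        exact (MemLp.toLp_eq_toLp_iff _ _).2 (hadd h h')
      map_smul' := fun c h => by
        rw [RingHom.id_apply, ← MemLp.toLp_const_smul]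
        exact (MemLp.toLp_eq_toLp_iff _ _).2 (hsmul c h) }
  have hT : ∀ h, T h =ᵐ[μ] S h := fun h => (hS h).coeFn_toLp
  have hcont : Continuous T := by
    refine LinearMap.continuous_of_seq_closed_graph T fun H h y hH hy => ?_
    obtain ⟨ns, hns, hae⟩ := (tendstoInMeasure_of_tendsto_Lp hH).exists_seq_tendsto_ae
    have hH' := hH.comp hns.tendsto_atTop
    have hy' := hy.comp hns.tendsto_atTop
    obtain ⟨ms, hms, hae'⟩ := (tendstoInMeasure_of_tendsto_Lp hy').exists_seq_tendsto_ae
    have hae'' := hlim _ h hH' hae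
    have hTn : ∀ᵐ x ∂μ, ∀ n, T (H n) x = S (H n) x := ae_all_iff.2 fun n => hT (H n)
    refine Lp.ext ?_
    filter_upwards [hae', hae'', hTn, hT h] with x h1 h2 h3 h4
    rw [h4]
    refine tendsto_nhds_unique h1 ?_
    refine (h2.comp hms.tendsto_atTop).congr fun n => ?_
    simp [h3]
  let T' : Lp ℝ 2 μ →L[ℝ] Lp ℝ 2 μ := ⟨T, hcont⟩
  refine ⟨‖T'‖, norm_nonneg _, fun h => ?_⟩
  have h1 := T'.le_opNorm h
  have h2 : ‖T' h‖ = (eLpNorm (S h) 2 μ).toReal := Lp.norm_toLp _ (hS h)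
  rw [h2] at h1
  rw [← ENNReal.ofReal_toReal (hS h).2.ne]
  exact ENNReal.ofReal_le_ofReal h1

/-- A function that multiplies `L²` into itself is essentially bounded. -/
theorem eLpNorm_top_lt_top_of_mul_memLp {ψ : ℝ → ℝ} (hψm : AEStronglyMeasurable ψ vol₊)
    (hψ : ∀ h : Lp ℝ 2 vol₊, MemLp (fun x => ψ x * h x) 2 vol₊) :
    eLpNorm ψ ∞ vol₊ < ∞ := by
  obtain ⟨C, hC0, hC⟩ := exists_eLpNorm_le_of_ae_tendsto (fun h x => ψ x * h x) hψ
    (fun h h' => by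
      filter_upwards [Lp.coeFn_add h h'] with x hx
      rw [hx, Pi.add_apply]
      ring)
    (fun c h => by
      filter_upwards [Lp.coeFn_smul c h] with x hx
      rw [hx, Pi.smul_apply, smul_eq_mul]
      ring)
    (fun H h _ hae => by
      filter_upwards [hae] with x hx using hx.const_mul _)
  obtain ⟨ψ', hψ'm, hψ'⟩ := hψm
  have hA : ∀ n : ℕ, vol₊ {x | x ∈ Iio (n : ℝ) ∧ C + 1 < |ψ' x|} = 0 := by
    intro n
    set A : Set ℝ := {x | x ∈ Iio (n : ℝ) ∧ C + 1 < |ψ' x|} with hAdef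
    have hAm : MeasurableSet A :=
      measurableSet_Iio.inter (measurableSet_lt measurable_const hψ'm.measurable.abs)
    have hAfin : vol₊ A ≠ ∞ := by
      refine ne_top_of_le_ne_top ?_ (measure_mono (fun x hx => hx.1 : A ⊆ Iio (n : ℝ)))
      rw [Measure.restrict_apply measurableSet_Iio, inter_comm, Ioi_inter_Iio]
      simp
    have h1 := hC (indicatorConstLp 2 hAm hAfin (1 : ℝ))
    -- on `A` the multiplication enlarges the norm by at least `C + 1`, which exceeds its bound
    have h2 : eLpNorm (indicatorConstLp 2 hAm hAfin (C + 1)) 2 vol₊ ≤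
        eLpNorm (fun x => ψ x * indicatorConstLp 2 hAm hAfin (1 : ℝ) x) 2 vol₊ := by
      refine eLpNorm_mono_ae ?_
      filter_upwards [hψ', indicatorConstLp_coeFn (p := 2) (hs := hAm) (hμs := hAfin) (c := C + 1),
        indicatorConstLp_coeFn (p := 2) (hs := hAm) (hμs := hAfin) (c := (1 : ℝ))]
        with x hx1 hx2 hx3
      rw [hx1, hx2, hx3]
      by_cases hx : x ∈ A
      · simp only [indicator_of_mem hx, mul_one, Real.norm_eq_abs]
        rw [abs_of_nonneg (by linarith)]
        exact hx.2.le
      · simp [indicator_of_notMem hx]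
    have h3 := h2.trans h1
    rw [← ENNReal.ofReal_toReal (Lp.eLpNorm_ne_top _), ENNReal.ofReal_le_ofReal_iff (by positivity),
      ← Lp.norm_def, norm_indicatorConstLp two_ne_zero ENNReal.ofNat_ne_top,
      norm_indicatorConstLp two_ne_zero ENNReal.ofNat_ne_top, norm_one, one_mul,
      Real.norm_of_nonneg (by linarith)] at h3
    have h4 : (vol₊).real A ^ (1 / (2 : ℝ≥0∞).toReal) = 0 := by
      have : 0 ≤ (vol₊).real A ^ (1 / (2 : ℝ≥0∞).toReal) := by positivity
      linarith
    rw [Real.rpow_eq_zero measureReal_nonneg (by simp)] at h4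
    exact (measureReal_eq_zero_iff hAfin).1 h4
  rw [eLpNorm_exponent_top]
  refine eLpNormEssSup_lt_top_of_ae_bound (C := C + 1) ?_
  have hall : ∀ᵐ x ∂vol₊, ∀ n : ℕ, x ∉ {x | x ∈ Iio (n : ℝ) ∧ C + 1 < |ψ' x|} :=
    ae_all_iff.2 fun n => measure_eq_zero_iff_ae_notMem.1 (hA n)
  filter_upwards [hall, hψ'] with x hx hx'
  obtain ⟨n, hn⟩ := exists_nat_gt x
  by_contra hlt
  rw [hx', not_le] at hlt
  exact hx n ⟨hn, hlt⟩

/-- The Hardy inequality in qualitative form. -/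
theorem memLp_mul_integral {W q h : ℝ → ℝ} (hW : MemLp W 2 vol₊)
    (hq : ∀ r : ℝ, 0 < r → MemLp q 2 (volume.restrict (Ioo 0 r)))
    (hq0 : ∀ᵐ x ∂vol₊, q x ≠ 0) (hh : MemLp h 2 vol₊)
    (hsup : (⨆ r : ℝ, ⨆ _ : 0 < r, eLpNorm W 2 (volume.restrict (Ioi r)) *
      eLpNorm q 2 (volume.restrict (Ioo (0 : ℝ) r))) < ∞) :
    MemLp (fun x => W x * ∫ t in (0 : ℝ)..x, h t * q t) 2 vol₊ := by
  have hqm : AEStronglyMeasurable q vol₊ := aestronglyMeasurable_halfLine fun r hr => (hq r hr).1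
  have hint : ∀ r : ℝ, 0 < r → IntegrableOn (fun t => h t * q t) (Ioo 0 r) := fun r hr =>
    (hh.mono_measure (Measure.restrict_mono_set _ Ioo_subset_Ioi_self)).integrable_mul (hq r hr)
  have hprim : ContinuousOn (fun x => ∫ t in (0 : ℝ)..x, h t * q t) (Ioi 0) := by
    have h1 := (hasACDeriv_taylorCoeff hint 1 0 0).continuousOn
    refine h1.congr fun x _ => ?_
    simp [taylorCoeff]
  refine ⟨hW.1.mul (hprim.aestronglyMeasurable measurableSet_Ioi), ?_⟩
  -- one is added because the Hardy inequality is stated for a nonzero constant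
  set A : ℝ≥0∞ := (⨆ r : ℝ, ⨆ _ : 0 < r, eLpNorm W 2 (volume.restrict (Ioi r)) *
      eLpNorm q 2 (volume.restrict (Ioo (0 : ℝ) r))) + 1 with hA
  have hAtop : A ≠ ∞ := ENNReal.add_ne_top.2 ⟨hsup.ne, ENNReal.one_ne_top⟩
  have key := lintegral_hardy (W := fun x => ‖W x‖ₑ) (q := fun x => ‖q x‖ₑ) (h := fun x => ‖h x‖ₑ)
    hW.1.enorm hqm.enorm hh.1.enorm (A := A) (by simp [hA]) hAtop
    (fun x hx => by
      intro h0
      rw [lintegral_eq_zero_iff' ((hqm.mono_set Ioo_subset_Ioi_self).enorm.pow_const 2)] at h0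
      have h1 := ae_restrict_of_ae_restrict_of_subset
        (Ioo_subset_Ioi_self : Ioo (0 : ℝ) x ⊆ Ioi 0) hq0
      have h2 : ∀ᵐ t ∂volume.restrict (Ioo (0 : ℝ) x), False := by
        filter_upwards [h0, h1] with t ht ht'
        simp at ht
        exact ht' ht
      rw [Filter.eventually_false_iff_eq_bot, ae_eq_bot, Measure.restrict_eq_zero,
        Real.volume_Ioo, ENNReal.ofReal_eq_zero] at h2
      linarith)
    (fun x hx => by
      rw [← eLpNorm_two_sq]
      exact ENNReal.pow_ne_top (hq x hx).2.ne)
    (by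
      rw [← eLpNorm_two_sq]
      exact ENNReal.pow_ne_top hW.2.ne)
    (fun x hx => by
      rw [← eLpNorm_two_sq, ← eLpNorm_two_sq, ← mul_pow]
      gcongr
      refine le_trans ?_ le_self_add
      exact le_iSup₂ (f := fun (r : ℝ) (_ : 0 < r) => eLpNorm W 2 (volume.restrict (Ioi r)) *
        eLpNorm q 2 (volume.restrict (Ioo (0 : ℝ) r))) x hx)
  rw [← eLpNorm_two_sq h] at key
  have h1 : eLpNorm (fun x => W x * ∫ t in (0 : ℝ)..x, h t * q t) 2 vol₊ ^ 2 ≤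
      4 * A ^ 2 * eLpNorm h 2 vol₊ ^ 2 := by
    rw [eLpNorm_two_sq]
    refine le_trans (setLIntegral_mono' measurableSet_Ioi fun x hx => ?_) key
    have hx : 0 < x := hx
    rw [enorm_mul]
    gcongr
    rw [intervalIntegral.integral_of_le hx.le, integral_Ioc_eq_integral_Ioo]
    refine (enorm_integral_le_lintegral_enorm _).trans (le_of_eq ?_)
    exact lintegral_congr fun t => by rw [enorm_mul, mul_comm]
  by_contra hcon
  rw [not_lt, top_le_iff] at hcon
  rw [hcon] at h1
  have h2 : 4 * A ^ 2 * eLpNorm h 2 vol₊ ^ 2 ≠ ∞ :=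
    ENNReal.mul_ne_top (ENNReal.mul_ne_top ENNReal.ofNat_ne_top (ENNReal.pow_ne_top hAtop))
      (ENNReal.pow_ne_top hh.2.ne)
  exact h2 (top_le_iff.1 (by simpa using h1))

/-! ### Sufficiency -/

theorem restrict_halfLine_Ioo (r : ℝ) : vol₊.restrict (Ioo 0 r) = volume.restrict (Ioo 0 r) := by
  rw [Measure.restrict_restrict measurableSet_Ioo, inter_eq_left.2 Ioo_subset_Ioi_self]

theorem integrableOn_mul_of_memLp {h U : ℝ → ℝ} (hh : MemLp h 2 vol₊) {r : ℝ}
    (hU : MemLp U 2 (volume.restrict (Ioo 0 r))) :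
    IntegrableOn (fun t => h t * U t) (Ioo 0 r) :=
  (hh.mono_measure (Measure.restrict_mono_set _ Ioo_subset_Ioi_self)).integrable_mul hU

theorem taylorCoeff_mul_eq (l : ℕ) (α : ℕ → ℝ) (h U : ℝ → ℝ) (k : ℕ) (x : ℝ) :
    taylorCoeff l α (fun t => h t * U t) k x =
      α k + (-1) ^ (l - k - 1) / ((l - k - 1).factorial : ℝ) *
        ∫ t in (0 : ℝ)..x, h t * (t ^ (l - k - 1) * U t) := by
  rw [taylorCoeff, ← intervalIntegral.integral_const_mul, Nat.sub_right_comm]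
  congr 1
  refine intervalIntegral.integral_congr fun t _ => ?_
  simp only [neg_pow t]
  ring

/-- For fixed `x` the coefficients `a_k(x)` are bounded linear functionals of `h = f^{(l)} u` in `L²`. -/
theorem exists_taylorCoeff_eq_inner {U : ℝ → ℝ} (l k : ℕ) {x : ℝ} (hx : 0 < x)
    (hU : MemLp U 2 (volume.restrict (Ioo 0 x))) :
    ∃ Q : Lp ℝ 2 vol₊, ∀ h : Lp ℝ 2 vol₊,
      taylorCoeff l 0 (fun t => h t * U t) k x = inner ℝ Q h := by
  set c : ℝ := (-1) ^ (l - k - 1) / ((l - k - 1).factorial : ℝ) with hc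
  set q : ℝ → ℝ := fun t => t ^ (l - k - 1) * U t with hq
  have hqm : MemLp q 2 (volume.restrict (Ioo 0 x)) := memLp_mul_of_continuous (by fun_prop) hU
  have hqi : MemLp ((Ioo 0 x).indicator q) 2 vol₊ := by
    rw [memLp_indicator_iff_restrict measurableSet_Ioo, restrict_halfLine_Ioo]
    exact hqm
  refine ⟨c • hqi.toLp, fun h => ?_⟩
  rw [taylorCoeff_mul_eq, Pi.zero_apply, zero_add, inner_smul_left, L2.inner_def]
  simp only [conj_trivial]
  rw [← hc]
  congr 1
  rw [intervalIntegral.integral_of_le hx.le, integral_Ioc_eq_integral_Ioo,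
    ← restrict_halfLine_Ioo, ← integral_indicator measurableSet_Ioo]
  refine integral_congr_ae ?_
  filter_upwards [hqi.coeFn_toLp] with t ht
  rw [ht]
  by_cases htx : t ∈ Ioo 0 x
  · simp [indicator_of_mem htx, hq]
  · simp [indicator_of_notMem htx]

/-- Each term of the sum in `productDeriv` is a Hardy operator applied to `h = f^{(l)} u`. -/
theorem memLp_taylorCoeff_mul {l k : ℕ} {u W h : ℝ → ℝ} (hu : ∀ᵐ x ∂vol₊, 0 < u x)
    (hU : ∀ r : ℝ, 0 < r → MemLp (fun x => (u x)⁻¹) 2 (volume.restrict (Ioo (0 : ℝ) r)))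
    (hW : MemLp W 2 vol₊)
    (hsup : (⨆ r : ℝ, ⨆ _ : 0 < r, eLpNorm W 2 (volume.restrict (Ioi r)) *
      eLpNorm (fun x => x ^ (l - k - 1) * (u x)⁻¹) 2 (volume.restrict (Ioo (0 : ℝ) r))) < ∞)
    (hh : MemLp h 2 vol₊) (α : ℕ → ℝ) :
    MemLp (fun x => taylorCoeff l α (fun t => h t * (u t)⁻¹) k x / (k.factorial : ℝ) * W x)
      2 vol₊ := by
  have h1 := memLp_mul_integral hW (q := fun t => t ^ (l - k - 1) * (u t)⁻¹)
    (fun r hr => memLp_mul_of_continuous (by fun_prop) (hU r hr))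
    (by
      filter_upwards [hu, ae_restrict_mem measurableSet_Ioi] with x hx hx0
      have hx0 : 0 < x := hx0
      positivity) hh hsup
  have h2 := (hW.const_mul (α k / (k.factorial : ℝ))).add
    (h1.const_mul ((-1) ^ (l - k - 1) / ((l - k - 1).factorial : ℝ) / (k.factorial : ℝ)))
  refine h2.ae_eq (ae_of_all _ fun x => ?_)
  simp only [Pi.add_apply, taylorCoeff_mul_eq]
  ring

/-- Sufficiency of the conditions. -/
theorem mem_multipliers_of_conditions {l m : ℕ} (hm : 1 ≤ m) (hml : m ≤ l) {u v φ : ℝ → ℝ}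
    {D : ℕ → ℝ → ℝ} (hu : ∀ᵐ x ∂vol₊, 0 < u x) (hv : ∀ᵐ x ∂vol₊, 0 < v x)
    (hU : ∀ r : ℝ, 0 < r → MemLp (fun x => (u x)⁻¹) 2 (volume.restrict (Ioo (0 : ℝ) r)))
    (hV : ∀ r : ℝ, 0 < r → MemLp (fun x => (v x)⁻¹) 2 (volume.restrict (Ioo (0 : ℝ) r)))
    (hD : ∀ k < l, IsWeakDeriv m (fun x => φ x * x ^ k) (D k))
    (hDv : ∀ k < l, MemLp (fun x => D k x * v x) 2 vol₊)
    (hsup : ∀ k < l, (⨆ r : ℝ, ⨆ _ : 0 < r,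
      eLpNorm (fun x => D k x * v x) 2 (volume.restrict (Ioi r)) *
        eLpNorm (fun x => x ^ (l - k - 1) * (u x)⁻¹) 2 (volume.restrict (Ioo (0 : ℝ) r))) < ∞)
    (hψ : m = l → MemLp (fun x => φ x * v x * (u x)⁻¹) ∞ vol₊) :
    φ ∈ multipliers (sobolevSpace l u) (sobolevSpace m v) := by
  rintro f ⟨-, g₀, hg₀, hg₀u⟩
  -- `f^{(l)}` is replaced by the a.e. equal function `h / u` with `h = f^{(l)} u` in `L²`
  set h : ℝ → ℝ := fun x => g₀ x * u x with hh
  set g : ℝ → ℝ := fun x => h x * (u x)⁻¹ with hgdef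
  have hgg : g₀ =ᵐ[vol₊] g := by
    filter_upwards [hu] with x hx
    simp [hgdef, hh, hx.ne']
  have hg : IsWeakDeriv l f g := hg₀.congr (Filter.EventuallyEq.refl _ _) hgg
  have hgint : ∀ r : ℝ, 0 < r → IntegrableOn g (Ioo 0 r) := fun r hr =>
    integrableOn_mul_of_memLp hg₀u (hU r hr)
  obtain ⟨α, hα⟩ := hg.exists_eq_taylorChain hgint
  have hφ0 : IsWeakDeriv m φ (D 0) := by simpa using hD 0 (by omega)
  have hD0int : ∀ r : ℝ, 0 < r → IntegrableOn (D 0) (Ioo 0 r) := by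
    intro r hr
    refine (integrableOn_mul_of_memLp (hDv 0 (by omega)) (hV r hr)).congr ?_
    filter_upwards [ae_restrict_of_ae_restrict_of_subset Ioo_subset_Ioi_self hv] with x hx
    field_simp
  obtain ⟨β, hβ⟩ := hφ0.exists_eq_taylorChain hD0int
  refine ⟨?_, productDeriv l m φ D α g, ?_, ?_⟩
  · have h1 := memLp_of_continuousOn_Icc ((continuousOn_taylorChain hD0int hm β).mul
      (continuousOn_taylorChain hgint (hm.trans hml) α))
    refine h1.ae_eq ?_
    filter_upwards [ae_restrict_of_ae_restrict_of_subset Ioo_subset_Ioi_self hα,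
      ae_restrict_of_ae_restrict_of_subset Ioo_subset_Ioi_self hβ] with x hx1 hx2
    rw [hx1, hx2, Pi.mul_apply]
  · refine (isWeakDeriv_mul_taylorChain hml (hm.trans hml) hD hgint α).congr ?_
      (Filter.EventuallyEq.refl _ _)
    filter_upwards [hα] with x hx
    rw [hx]
  · have hterm : ∀ k ∈ Finset.range l, MemLp
        (fun x => taylorCoeff l α g k x / (k.factorial : ℝ) * (D k x * v x)) 2 vol₊ := by
      exact fun k hk => memLp_taylorCoeff_mul hu hU (hDv k (Finset.mem_range.1 hk))
        (hsup k (Finset.mem_range.1 hk)) hg₀u α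
    have hlast : MemLp (fun x => (if m = l then φ x * g x else 0) * v x) 2 vol₊ := by
      split_ifs with hmleq
      · have h1 : MemLp (fun x => (φ x * v x * (u x)⁻¹) * h x) 2 vol₊ := hg₀u.mul' (hψ hmleq)
        refine h1.ae_eq (ae_of_all _ fun x => ?_)
        simp only [hgdef]
        ring
      · simp
    refine ((memLp_finsetSum _ hterm).add hlast).ae_eq (ae_of_all _ fun x => ?_)
    simp only [Pi.add_apply, productDeriv, add_mul, Finset.sum_mul, mul_assoc]

/-! ### Necessity -/

theorem pow_mem_sobolevSpace {l k : ℕ} (hk : k < l) (u : ℝ → ℝ) :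
    (fun x : ℝ => x ^ k) ∈ sobolevSpace l u := by
  refine ⟨memLp_of_continuousOn_Icc (by fun_prop), fun _ => 0, ?_, by simp⟩
  refine (isDerivChain_pow k l).isWeakDeriv.congr (ae_of_all _ fun x => ?_)
    (ae_of_all _ fun x => ?_)
  · simp
  · simp [Nat.descFactorial_of_lt hk]

section Necessity

variable {l m : ℕ} {u v φ : ℝ → ℝ} {D : ℕ → ℝ → ℝ}

theorem memLp_productDeriv_of_mem_multipliers (hm : 1 ≤ m) (hml : m ≤ l)
    (hu : ∀ᵐ x ∂vol₊, 0 < u x)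
    (hU : ∀ r : ℝ, 0 < r → MemLp (fun x => (u x)⁻¹) 2 (volume.restrict (Ioo (0 : ℝ) r)))
    (hφ : φ ∈ multipliers (sobolevSpace l u) (sobolevSpace m v))
    (hD : ∀ k < l, IsWeakDeriv m (fun x => φ x * x ^ k) (D k)) {h : ℝ → ℝ}
    (hh : MemLp h 2 vol₊) :
    MemLp (fun x => productDeriv l m φ D 0 (fun t => h t * (u t)⁻¹) x * v x) 2 vol₊ := by
  have hgint : ∀ r : ℝ, 0 < r → IntegrableOn (fun t => h t * (u t)⁻¹) (Ioo 0 r) := fun r hr =>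
    integrableOn_mul_of_memLp hh (hU r hr)
  obtain ⟨-, G, hG, hGv⟩ := hφ (taylorChain l 0 (fun t => h t * (u t)⁻¹) 0)
    ⟨memLp_of_continuousOn_Icc (continuousOn_taylorChain hgint (hm.trans hml) 0), _,
      isWeakDeriv_taylorChain hgint l 0, hh.ae_eq (by
        filter_upwards [hu] with x hx
        field_simp)⟩
  have h1 := hG.unique (isWeakDeriv_mul_taylorChain hml (hm.trans hml) hD hgint 0)
  refine hGv.ae_eq ?_
  filter_upwards [h1] with x hx
  rw [hx]

/-- A multiplier is automatically bounded on the functions with zero Taylor polynomial at `0`. -/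
theorem exists_productDeriv_bound (hm : 1 ≤ m) (hml : m ≤ l) (hu : ∀ᵐ x ∂vol₊, 0 < u x)
    (hU : ∀ r : ℝ, 0 < r → MemLp (fun x => (u x)⁻¹) 2 (volume.restrict (Ioo (0 : ℝ) r)))
    (hφ : φ ∈ multipliers (sobolevSpace l u) (sobolevSpace m v))
    (hD : ∀ k < l, IsWeakDeriv m (fun x => φ x * x ^ k) (D k)) :
    ∃ C : ℝ, 0 ≤ C ∧ ∀ h : Lp ℝ 2 vol₊,
      eLpNorm (fun x => productDeriv l m φ D 0 (fun t => h t * (u t)⁻¹) x * v x) 2 vol₊ ≤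
        ENNReal.ofReal (C * ‖h‖) := by
  refine exists_eLpNorm_le_of_ae_tendsto
    (fun h x => productDeriv l m φ D 0 (fun t => h t * (u t)⁻¹) x * v x)
    (fun h => memLp_productDeriv_of_mem_multipliers hm hml hu hU hφ hD (Lp.memLp h)) ?_ ?_ ?_
  · intro h h'
    filter_upwards [Lp.coeFn_add h h', ae_restrict_mem measurableSet_Ioi] with x hx hx0
    choose Q hQ using fun k => exists_taylorCoeff_eq_inner l k hx0 (hU x hx0)
    simp only [productDeriv, hQ, inner_add_right, hx, Pi.add_apply, add_mul, add_div,
      Finset.sum_add_distrib]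
    split_ifs <;> ring
  · intro c h
    filter_upwards [Lp.coeFn_smul c h, ae_restrict_mem measurableSet_Ioi] with x hx hx0
    choose Q hQ using fun k => exists_taylorCoeff_eq_inner l k hx0 (hU x hx0)
    simp only [productDeriv, hQ, inner_smul_right, hx, Pi.smul_apply, smul_eq_mul, mul_div_assoc,
      mul_assoc, ← Finset.mul_sum]
    split_ifs <;> ring
  · intro H h hH hae
    filter_upwards [hae, ae_restrict_mem measurableSet_Ioi] with x hx hx0
    choose Q hQ using fun k => exists_taylorCoeff_eq_inner l k hx0 (hU x hx0)
    simp only [productDeriv, hQ]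
    refine Filter.Tendsto.mul_const _ (Filter.Tendsto.add ?_ ?_)
    · exact tendsto_finsetSum _ fun k _ =>
        ((Filter.Tendsto.inner tendsto_const_nhds hH).div_const _).mul_const _
    · split_ifs
      · exact (hx.mul_const _).const_mul _
      · exact tendsto_const_nhds

/-- If `f^{(l)} u` is supported in `(0, r)`, the coefficients `a_k` are constant to the right of `r`. -/
theorem taylorCoeff_indicator_mul_eq {p : ℝ → ℝ} {r x : ℝ} (hr : 0 < r) (hrx : r < x)
    {h : ℝ → ℝ} (hh : h =ᵐ[vol₊] (Ioo 0 r).indicator fun t => p t * (u t)⁻¹) (k : ℕ) :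
    taylorCoeff l 0 (fun t => h t * (u t)⁻¹) k x =
      (-1) ^ (l - k - 1) / ((l - k - 1).factorial : ℝ) *
        ∫ t in Ioo 0 r, p t * t ^ (l - k - 1) * (u t ^ 2)⁻¹ := by
  rw [taylorCoeff_mul_eq, Pi.zero_apply, zero_add]
  congr 1
  rw [intervalIntegral.integral_of_le (hr.trans hrx).le, integral_Ioc_eq_integral_Ioo]
  have h1 : ∀ᵐ t ∂volume.restrict (Ioo 0 x), h t * (t ^ (l - k - 1) * (u t)⁻¹) =
      (Ioo 0 r).indicator (fun t => p t * t ^ (l - k - 1) * (u t ^ 2)⁻¹) t := by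
    filter_upwards [ae_restrict_of_ae_restrict_of_subset Ioo_subset_Ioi_self hh] with t ht
    rw [ht]
    by_cases htr : t ∈ Ioo 0 r
    · simp only [indicator_of_mem htr]
      rw [← inv_pow]
      ring
    · simp [indicator_of_notMem htr]
  rw [integral_congr_ae h1, setIntegral_indicator measurableSet_Ioo,
    inter_eq_right.2 (Ioo_subset_Ioo_right hrx.le)]

/-- Necessity of the supremum condition. For `f^{(l)} = p u^{-2}` on `(0, r)` and `0` elsewhere, where `p`
is dual to the monomial of degree `l - k - 1`, all coefficients but `a_k` vanish beyond `r`, so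
that `(φ f)^{(m)}` is a multiple of `(φ x^k)^{(m)}` there. -/
theorem iSup_lt_top_of_mem_multipliers {δ : ℝ} (hm : 1 ≤ m) (hml : m ≤ l)
    (hu : ∀ᵐ x ∂vol₊, 0 < u x) (huB : DoublingClass δ fun x => (u x ^ 2)⁻¹)
    (hφ : φ ∈ multipliers (sobolevSpace l u) (sobolevSpace m v))
    (hD : ∀ k < l, IsWeakDeriv m (fun x => φ x * x ^ k) (D k))
    (hDv : ∀ k < l, MemLp (fun x => D k x * v x) 2 vol₊) {k : ℕ} (hk : k < l) :
    (⨆ r : ℝ, ⨆ _ : 0 < r, eLpNorm (fun x => D k x * v x) 2 (volume.restrict (Ioi r)) *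
      eLpNorm (fun x => x ^ (l - k - 1) * (u x)⁻¹) 2 (volume.restrict (Ioo (0 : ℝ) r))) < ∞ := by
  have hU := fun (r : ℝ) (hr : 0 < r) => huB.memLp_inv hu hr
  obtain ⟨C, hC0, hC⟩ := exists_productDeriv_bound hm hml hu hU hφ hD
  obtain ⟨K, r₀, hK0, hr₀, hdual⟩ := huB.exists_dual_polynomial l
  set N : ℕ := l - k - 1 with hN
  have hq : ∀ r : ℝ, 0 < r → MemLp (fun x => x ^ N * (u x)⁻¹) 2 (volume.restrict (Ioo 0 r)) :=
    fun r hr => memLp_mul_of_continuous (by fun_prop) (hU r hr)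
  set c : ℝ := (-1) ^ N / (N.factorial : ℝ) / (k.factorial : ℝ) with hc
  have hc0 : c ≠ 0 := by positivity
  -- for large `r`, test on a function of the dual basis of the monomials on `(0, r)`
  have hlarge : ∀ r, r₀ ≤ r →
      eLpNorm (fun x => D k x * v x) 2 (volume.restrict (Ioi r)) *
        eLpNorm (fun x => x ^ N * (u x)⁻¹) 2 (volume.restrict (Ioo (0 : ℝ) r)) ≤
      ENNReal.ofReal (|c⁻¹| * C * √K) := by
    intro r hr
    have hr0 : 0 < r := hr₀.trans_le hr
    obtain ⟨p, hpc, hmom, hpK⟩ := hdual r hr ⟨N, by omega⟩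
    have hpU : MemLp (fun t => p t * (u t)⁻¹) 2 (volume.restrict (Ioo 0 r)) :=
      memLp_mul_of_continuous hpc (hU r hr0)
    have hpi : MemLp ((Ioo 0 r).indicator fun t => p t * (u t)⁻¹) 2 vol₊ := by
      rw [memLp_indicator_iff_restrict measurableSet_Ioo, restrict_halfLine_Ioo]
      exact hpU
    set h : Lp ℝ 2 vol₊ := hpi.toLp with hh
    have hnorm : ‖h‖ = √(∫ t in Ioo 0 r, p t ^ 2 * (u t ^ 2)⁻¹) := by
      rw [hh, Lp.norm_toLp, eLpNorm_indicator_eq_eLpNorm_restrict measurableSet_Ioo,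
        restrict_halfLine_Ioo, eLpNorm_two_eq_sqrt hpU, ENNReal.toReal_ofReal (Real.sqrt_nonneg _)]
      simp only [mul_pow, inv_pow]
    have hval : ∀ᵐ x ∂volume.restrict (Ioi r), D k x * v x =
        c⁻¹ * (productDeriv l m φ D 0 (fun t => h t * (u t)⁻¹) x * v x) := by
      have h1 := ae_restrict_of_ae_restrict_of_subset (Ioi_subset_Ioi hr0.le) hpi.coeFn_toLp
      filter_upwards [h1, ae_restrict_mem measurableSet_Ioi] with x hx hxr
      have hxr : r < x := hxr
      have hx0 : h x = 0 := by
        rw [hh, hx, indicator_of_notMem]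
        exact fun hmem => absurd hmem.2 (not_lt.2 hxr.le)
      have h2 : ∀ i ∈ Finset.range l,
          taylorCoeff l 0 (fun t => h t * (u t)⁻¹) i x / (i.factorial : ℝ) * D i x =
            if i = k then c * D k x else 0 := by
        intro i hi
        have hi : i < l := by simpa using hi
        rw [taylorCoeff_indicator_mul_eq hr0 hxr hpi.coeFn_toLp]
        have h3 := hmom ⟨l - i - 1, by omega⟩
        simp only [Fin.mk.injEq] at h3
        rw [h3]
        by_cases hik : i = k
        · subst hik
          simp [hc, hN]
        · rw [if_neg (by omega), if_neg hik]
          simp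
      rw [productDeriv, Finset.sum_congr rfl h2, hx0, Finset.sum_ite_eq',
        if_pos (Finset.mem_range.2 hk)]
      simp only [zero_mul, mul_zero, ite_self, add_zero]
      field_simp
    have hD1 : eLpNorm (fun x => D k x * v x) 2 (volume.restrict (Ioi r)) ≤
        ENNReal.ofReal (|c⁻¹| * (C * ‖h‖)) := by
      rw [eLpNorm_congr_ae hval, ENNReal.ofReal_mul (abs_nonneg _)]
      have h4 := eLpNorm_const_smul (p := 2) (μ := volume.restrict (Ioi r)) c⁻¹
        (fun x => productDeriv l m φ D 0 (fun t => h t * (u t)⁻¹) x * v x)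
      have h5 : (fun x => c⁻¹ * (productDeriv l m φ D 0 (fun t => h t * (u t)⁻¹) x * v x)) =
          c⁻¹ • fun x => productDeriv l m φ D 0 (fun t => h t * (u t)⁻¹) x * v x := rfl
      rw [h5, h4, ← Real.norm_eq_abs, ofReal_norm]
      gcongr
      refine le_trans (eLpNorm_mono_measure _ ?_) (hC h)
      exact Measure.restrict_mono_set _ (Ioi_subset_Ioi hr0.le)
    have hq1 : eLpNorm (fun x => x ^ N * (u x)⁻¹) 2 (volume.restrict (Ioo (0 : ℝ) r)) ≤
        ENNReal.ofReal (√((r ^ N) ^ 2 * ∫ t in Ioo 0 r, (u t ^ 2)⁻¹)) := by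
      rw [eLpNorm_two_eq_sqrt (hq r hr0)]
      refine ENNReal.ofReal_le_ofReal (Real.sqrt_le_sqrt ?_)
      rw [← integral_const_mul]
      refine setIntegral_mono_on ?_ ((huB.integrableOn hr0).const_mul _) measurableSet_Ioo ?_
      · exact (memLp_two_iff_integrable_sq (hq r hr0).1).1 (hq r hr0)
      · intro t ht
        rw [mul_pow, inv_pow]
        have := ht.1.le
        have := ht.2.le
        gcongr
    calc _ ≤ ENNReal.ofReal (|c⁻¹| * (C * ‖h‖)) *
          ENNReal.ofReal (√((r ^ N) ^ 2 * ∫ t in Ioo 0 r, (u t ^ 2)⁻¹)) := mul_le_mul' hD1 hq1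
      _ = ENNReal.ofReal (|c⁻¹| * C * (√(∫ t in Ioo 0 r, p t ^ 2 * (u t ^ 2)⁻¹) *
          √((r ^ N) ^ 2 * ∫ t in Ioo 0 r, (u t ^ 2)⁻¹))) := by
        rw [← ENNReal.ofReal_mul (by positivity), hnorm]
        congr 1
        ring
      _ ≤ ENNReal.ofReal (|c⁻¹| * C * √K) := by
        refine ENNReal.ofReal_le_ofReal (mul_le_mul_of_nonneg_left ?_ (by positivity))
        rw [← Real.sqrt_mul (integral_nonneg fun t => by positivity)]
        exact Real.sqrt_le_sqrt hpK
  -- for `r ≤ r₀` both factors are monotone in `r` and finite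
  refine lt_of_le_of_lt (b := max (ENNReal.ofReal (|c⁻¹| * C * √K))
    (eLpNorm (fun x => D k x * v x) 2 vol₊ *
      eLpNorm (fun x => x ^ N * (u x)⁻¹) 2 (volume.restrict (Ioo (0 : ℝ) r₀)))) ?_
    (max_lt ENNReal.ofReal_lt_top (ENNReal.mul_lt_top (hDv k hk).2 (hq r₀ hr₀).2))
  refine iSup₂_le fun r hr => ?_
  rcases le_total r₀ r with hrr | hrr
  · exact (hlarge r hrr).trans (le_max_left _ _)
  · refine le_trans (mul_le_mul' ?_ ?_) (le_max_right _ _)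
    · exact eLpNorm_mono_measure _ (Measure.restrict_mono_set _ (Ioi_subset_Ioi hr.le))
    · exact eLpNorm_mono_measure _ (Measure.restrict_mono_set _ (Ioo_subset_Ioo_right hrr))

/-- Necessity of the boundedness of `φ v / u`: once the other conditions are known, the integral terms of
`(φ f)^{(l)} v` are in `L²` by the Hardy inequality, hence so is the remaining term. -/
theorem eLpNorm_top_lt_top_of_mem_multipliers (hm : 1 ≤ m) (hml : m = l)
    (hu : ∀ᵐ x ∂vol₊, 0 < u x)
    (hU : ∀ r : ℝ, 0 < r → MemLp (fun x => (u x)⁻¹) 2 (volume.restrict (Ioo (0 : ℝ) r)))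
    (hφ : φ ∈ multipliers (sobolevSpace l u) (sobolevSpace m v))
    (hψm : AEStronglyMeasurable (fun x => φ x * v x * (u x)⁻¹) vol₊)
    (hD : ∀ k < l, IsWeakDeriv m (fun x => φ x * x ^ k) (D k))
    (hDv : ∀ k < l, MemLp (fun x => D k x * v x) 2 vol₊)
    (hsup : ∀ k < l, (⨆ r : ℝ, ⨆ _ : 0 < r,
      eLpNorm (fun x => D k x * v x) 2 (volume.restrict (Ioi r)) *
        eLpNorm (fun x => x ^ (l - k - 1) * (u x)⁻¹) 2 (volume.restrict (Ioo (0 : ℝ) r))) < ∞) :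
    eLpNorm (fun x => φ x * v x * (u x)⁻¹) ∞ vol₊ < ∞ := by
  refine eLpNorm_top_lt_top_of_mul_memLp hψm fun h => ?_
  have h1 := memLp_productDeriv_of_mem_multipliers hm hml.le hu hU hφ hD (Lp.memLp h)
  have h2 := memLp_finsetSum (Finset.range l) fun k hk =>
    memLp_taylorCoeff_mul hu hU (hDv k (Finset.mem_range.1 hk)) (hsup k (Finset.mem_range.1 hk))
      (Lp.memLp h) 0
  refine (h1.sub h2).ae_eq (ae_of_all _ fun x => ?_)
  simp only [Pi.sub_apply, productDeriv, if_pos hml, add_mul, Finset.sum_mul, mul_assoc]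
  ring

end Necessity

end WeightedSobolev

theorem theorem2 (l m : ℕ) (hm : 1 ≤ m) (hml : m ≤ l)
    (δ : ℝ) (hδ : 0 ≤ δ) (u v : ℝ → ℝ)
    (hu : ∀ᵐ x ∂(volume.restrict (Ioi (0 : ℝ))), 0 < u x)
    (hv : ∀ᵐ x ∂(volume.restrict (Ioi (0 : ℝ))), 0 < v x)
    (huB : WeightedSobolev.DoublingClass δ (fun x => (u x ^ 2)⁻¹))
    (hvL : ∀ r : ℝ, 0 < r → MemLp (fun x => (v x)⁻¹) 2 (volume.restrict (Ioo (0 : ℝ) r)))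
    (φ : ℝ → ℝ) :
    φ ∈ WeightedSobolev.multipliers
        (WeightedSobolev.sobolevSpace l u) (WeightedSobolev.sobolevSpace m v) ↔
      (∃ D : ℕ → ℝ → ℝ,
        (∀ k < l, WeightedSobolev.IsWeakDeriv m (fun x => φ x * x ^ k) (D k)) ∧
        (∀ k < l, MemLp (fun x => D k x * v x) 2 (volume.restrict (Ioi (0 : ℝ)))) ∧
        (∀ k < l, (⨆ r : ℝ, ⨆ _ : 0 < r,
          eLpNorm (fun x => D k x * v x) 2 (volume.restrict (Ioi r)) *
            eLpNorm (fun x => x ^ (l - k - 1) * (u x)⁻¹) 2 (volume.restrict (Ioo (0 : ℝ) r))) < ∞)) ∧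
      (m = l → eLpNorm (fun x => φ x * v x * (u x)⁻¹) ∞ (volume.restrict (Ioi (0 : ℝ))) < ∞) := by
  open WeightedSobolev in
  have hU := fun (r : ℝ) (hr : 0 < r) => huB.memLp_inv hu hr
  have hum : AEStronglyMeasurable (fun x => (u x)⁻¹) (volume.restrict (Ioi (0 : ℝ))) :=
    aestronglyMeasurable_halfLine fun r hr => (hU r hr).1
  have hvm : AEStronglyMeasurable v (volume.restrict (Ioi (0 : ℝ))) := by
    have h1 := aestronglyMeasurable_halfLine fun r hr => (hvL r hr).1
    exact h1.aemeasurable.inv.aestronglyMeasurable.congr (ae_of_all _ fun x => by simp)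
  have hψm : ∀ {g : ℝ → ℝ}, IsWeakDeriv m (fun x => φ x * x ^ 0) g →
      AEStronglyMeasurable (fun x => φ x * v x * (u x)⁻¹) (volume.restrict (Ioi (0 : ℝ))) := by
    intro g hg
    obtain ⟨F, hF, hF0, -⟩ := hg.exists_chain
    have h1 := (hF 0 hm).continuousOn.aestronglyMeasurable (μ := volume) measurableSet_Ioi
    have h2 : AEStronglyMeasurable φ (volume.restrict (Ioi (0 : ℝ))) :=
      h1.congr (hF0.symm.trans (ae_of_all _ fun x => by simp))
    exact (h2.mul hvm).mul hum
  constructor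
  · intro hφ
    have hex : ∀ k, ∃ G : ℝ → ℝ, k < l → IsWeakDeriv m (fun x => φ x * x ^ k) G ∧
        MemLp (fun x => G x * v x) 2 (volume.restrict (Ioi (0 : ℝ))) := by
      intro k
      by_cases hk : k < l
      · obtain ⟨-, G, hG, hGv⟩ := hφ _ (pow_mem_sobolevSpace hk u)
        exact ⟨G, fun _ => ⟨hG, hGv⟩⟩
      · exact ⟨0, fun h => absurd h hk⟩
    choose D hDall using hex
    have hD := fun k hk => (hDall k hk).1
    have hDv := fun k hk => (hDall k hk).2
    have hsup := fun k hk =>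
      iSup_lt_top_of_mem_multipliers (k := k) hm hml hu huB hφ hD hDv hk
    exact ⟨⟨D, hD, hDv, hsup⟩, fun hmleq => eLpNorm_top_lt_top_of_mem_multipliers hm hmleq hu hU
      hφ (hψm (hD 0 (by omega))) hD hDv hsup⟩
  · rintro ⟨⟨D, hD, hDv, hsup⟩, hψ⟩
    exact mem_multipliers_of_conditions hm hml hu hv hU hvL hD hDv hsup fun hmleq =>
      ⟨hψm (hD 0 (by omega)), hψ hmleq⟩
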